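/- **Setting.** A $\dagger$-SMC is a symmetric monoidal category with an identity-on-objects, involutive contravariant functor $\dagger$ that preserves $\otimes$ and sends each associator, unitor and symmetry to its inverse. Let $\mathcal C$ be a $\dagger$-SMC with unit object $I$; a state of $\mathcal H$ is a morphism $I\to\mathcal H$. *Observables.* A $\dagger$-qSCFA on $\mathcal H$ is a cocommutative comonoid $(\delta,\epsilon)$ on $\mathcal H$ such that, with $\mu=\delta^\dagger$ and $\eta=\epsilon^\dagger$, the Frobenius law $(1\otimes\mu)(\delta\otimes 1)=\delta\mu=(\mu\otimes 1)(1\otimes\delta)$ holds and $\mu\delta=c\cdot 1_{\mathcal H}$ for an invertible scalar $c$. A pair $(Z,X)$ of $\dagger$-qSCFAs on $\mathcal H$ is *strongly complementary* if $\delta_Z\mu_X=(\mu_X\otimes\mu_X)(1\otimes\mathrm{swap}\otimes 1)(\delta_Z\otimes\delta_Z)$, $\delta_Z\eta_X=\eta_X\otimes\eta_X$ and $\epsilon_Z\mu_X=\epsilon_Z\otimes\epsilon_Z$. A state $j$ is *$X$-classical* if $\delta_X j=j\otimes j$. A *$Z$-phase state* is a state $\alpha$ with $(\alpha^\dagger\otimes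 1)\delta_Z\alpha=\eta_Z$; its *phase* is $\mu_Z(\alpha\otimes-):\mathcal H\to\mathcal H$. Phase states are added by $\alpha+\beta=\mu_Z(\alpha\otimes\beta)$, with zero $\eta_Z$. *Mermin measurements.* The $N$-partite GHZ state of $Z$ is the $Z$-spider $I\to\mathcal H^{\otimes N}$. Given $Z$-phase states $\alpha_1,\dots,\alpha_N$ whose sum is $X$-classical, let $\psi$ be the GHZ state with the phase of $\alpha_i$ applied to its $i$-th component. The *Mermin measurement* $(\alpha_1,\dots,\alpha_N)$ is the state of $\mathcal H^{\otimes N}$ obtained by measuring each component of $\psi$ in the structure $X$: apply $\delta_X$ to each component of $\psi$, keep one output of each $\delta_X$, and apply the effect $\psi^\dagger$ to the other $N$ outputs. A *Mermin scenario* for $(Z,X)$ is a finite non-empty family $(\alpha^s_1,\dots,\alpha^s_N)_{s=1,\dots,S}$ of $N$-partite Mermin measurements; let $a_1,\dots,a_M$ be the distinct phases in it. Its *local map* $\mathcal H^{\otimes(M\cdot N)}\to\mathcal H^{\otimes(N\cdot S)}$ has one input wire for each $(a_r,\text{system } i)$, one output wire for each $(\text{measurement } s,\text{system } j)$, and an $X$-spider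 on each input wire, connected to output $(s,j)$ if and only if $i=j$ and $\alpha^s_j=a_r$. A *local hidden variable model* is a state $\Lambda'$ of $\mathcal H^{\otimes(M\cdot N)}$ such that, for every $s$, applying the local map to $\Lambda'$ and then $\epsilon_X$ to every output wire of all measurements $t\ne s$ gives the Mermin measurement $(\alpha_1^s,\dots,\alpha_N^s)$. $\mathcal C$ is *Mermin non-local* if some Mermin scenario for some strongly complementary pair of $\dagger$-qSCFAs has no local hidden variable model, and *Mermin local* otherwise. *Algebraic extensions.* An abelian group $G$ is a *non-trivial algebraic extension* of a subgroup $K$ if some finite system $\sum_j n^p_j x_j=h^p$, with $n^p_j\in\mathbb Z$ and $h^p\in K$, has a solution in $G$ but none in $K$; otherwise it is a *trivial algebraic extension*. *The toy theory.* $\mathbf{Spekk}$ is the following sub-$\dagger$-SMC of the category of finite sets and relations (with tensor $\times$ and dagger the relational converse). Its objects are the iterated Cartesian products of the one-element set $I$ and $\mathrm{IV}=\{1,2,3,4\}$. Its morphisms are generated, under composition, Cartesian product and converse, by the identity, unit, associativity and symmetry bijections, all permutations of $\mathrm{IV}$, the relation $\delta:\mathrm{IV}\to\mathrm{IV}\times\mathrm{IV}$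 with $1\sim(1,1),(2,2)$; $2\sim(1,2),(2,1)$; $3\sim(3,3),(4,4)$; $4\sim(3,4),(4,3)$, and the relation $\epsilon:\mathrm{IV}\to I$ with $1,3\sim *$. Let $Z=(\delta,\epsilon)$ and let $X$ be the image of $Z$ under the transposition of $2$ and $3$; both are $\dagger$-qSCFAs on $\mathrm{IV}$. **Statement.** The pair $(Z,X)$ in $\mathbf{Spekk}$ is strongly complementary; the $Z$-phase states form under addition a group isomorphic to $\mathbb Z_2\times\mathbb Z_2$, in which the $X$-classical ones form a subgroup isomorphic to $\mathbb Z_2$; and the former is a trivial algebraic extension of the latter. Moreover, $\mathbf{Spekk}$ is Mermin local. -/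

import Mathlib

open CategoryTheory MonoidalCategory

universe v u

/-! ## Dagger symmetric monoidal categories -/

/-- A dagger structure on a symmetric monoidal category: an identity-on-objects involutive
contravariant functor, compatible with tensor products, for which the structural isomorphisms are
unitary. -/
class DaggerSMC (C : Type u) [Category.{v} C] [MonoidalCategory C] [SymmetricCategory C] where
  dagger : {X Y : C} → (X ⟶ Y) → (Y ⟶ X)
  dagger_id : ∀ X : C, dagger (𝟙 X) = 𝟙 X
  dagger_comp : ∀ {X Y Z : C} (f : X ⟶ Y) (g : Y ⟶ Z), dagger (f ≫ g) = dagger g ≫ dagger f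
  dagger_dagger : ∀ {X Y : C} (f : X ⟶ Y), dagger (dagger f) = f
  dagger_tensor : ∀ {X Y X' Y' : C} (f : X ⟶ Y) (g : X' ⟶ Y'),
    dagger (f ⊗ₘ g) = dagger f ⊗ₘ dagger g
  dagger_associator : ∀ X Y Z : C, dagger (α_ X Y Z).hom = (α_ X Y Z).inv
  dagger_leftUnitor : ∀ X : C, dagger (λ_ X).hom = (λ_ X).inv
  dagger_rightUnitor : ∀ X : C, dagger (ρ_ X).hom = (ρ_ X).inv
  dagger_braiding : ∀ X Y : C, dagger (β_ X Y).hom = (β_ X Y).inv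

postfix:max "†" => DaggerSMC.dagger

/-! ## Tensor powers and wirings -/

section Wiring

variable {C : Type u} [Category.{v} C] [MonoidalCategory C]

/-- The tensor power `X ⊗ (X ⊗ (⋯ ⊗ 𝟙))` with `n` factors. -/
def tpow (X : C) : ℕ → C
  | 0 => 𝟙_ C
  | n + 1 => X ⊗ tpow X n

/-- The tensor product of `n` morphisms `X ⟶ Y`. -/
def tensorHoms {X Y : C} : (n : ℕ) → (Fin n → (X ⟶ Y)) → (tpow X n ⟶ tpow Y n)
  | 0, _ => 𝟙 (𝟙_ C)
  | n + 1, f => f 0 ⊗ₘ tensorHoms n (fun i => f i.succ)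

/-- Discard all of `n` wires, given a map `d` that discards one of them. -/
def discardAll {X : C} (d : X ⟶ 𝟙_ C) : (n : ℕ) → (tpow X n ⟶ 𝟙_ C)
  | 0 => 𝟙 (𝟙_ C)
  | n + 1 => (d ⊗ₘ discardAll d n) ≫ (λ_ (𝟙_ C)).hom

/-- Keep the `i`-th of `n` wires and discard all the others with `d`. -/
def keepOne {X : C} (d : X ⟶ 𝟙_ C) : (n : ℕ) → Fin n → (tpow X n ⟶ X)
  | 0 => fun i => i.elim0
  | n + 1 => Fin.cases (X ◁ discardAll d n ≫ (ρ_ X).hom)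
      (fun i => d ▷ tpow X n ≫ (λ_ (tpow X n)).hom ≫ keepOne d n i)

variable [SymmetricCategory C]

/-- The reordering `(X ⊗ Y)^{⊗ n} ⟶ X^{⊗ n} ⊗ Y^{⊗ n}`. -/
def unzip (X Y : C) : (n : ℕ) → (tpow (X ⊗ Y) n ⟶ tpow X n ⊗ tpow Y n)
  | 0 => (λ_ (𝟙_ C)).inv
  | n + 1 => ((X ⊗ Y) ◁ unzip X Y n) ≫ tensorμ X Y (tpow X n) (tpow Y n)

/-- The reordering `(X^{⊗ m})^{⊗ n} ⟶ (X^{⊗ n})^{⊗ m}` that makes the `j`-th wire of the `i`-th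
group the `i`-th wire of the `j`-th group. -/
def regroup (X : C) (n : ℕ) : (m : ℕ) → (tpow (tpow X m) n ⟶ tpow (tpow X n) m)
  | 0 => discardAll (𝟙 (𝟙_ C)) n
  | m + 1 => unzip X (tpow X m) n ≫ (tpow X n ◁ regroup X n m)

end Wiring

/-! ## Observables, strong complementarity, phases -/

section Mermin

variable {C : Type u} [Category.{v} C] [MonoidalCategory C] [SymmetricCategory C] [DaggerSMC C]

/-- A commutative quasi-special dagger-Frobenius algebra on `H`: a cocommutative comonoid which
together with its dagger, a monoid, satisfies the Frobenius equation, and for which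
`comul ≫ comul†` is an invertible scalar multiple of the identity. -/
structure DaggerQSCFA (H : C) extends ComonObj H where
  comul_comm : comul ≫ (β_ H H).hom = comul
  frobenius_left : (H ◁ comul) ≫ (α_ H H H).inv ≫ (comul† ▷ H) = comul† ≫ comul
  frobenius_right : (comul ▷ H) ≫ (α_ H H H).hom ≫ (H ◁ comul†) = comul† ≫ comul
  quasiSpecial : ∃ c : 𝟙_ C ≅ 𝟙_ C,
    comul ≫ comul† = (λ_ H).inv ≫ (c.hom ▷ H) ≫ (λ_ H).hom

namespace DaggerQSCFA

variable {H : C}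

/-- The multiplication, the dagger of the comultiplication. -/
def mul (A : DaggerQSCFA H) : H ⊗ H ⟶ H := A.comul†

/-- The unit, the dagger of the counit. -/
def one (A : DaggerQSCFA H) : 𝟙_ C ⟶ H := A.counit†

/-- The product state `φ ⊗ ψ` of `H ⊗ K`. -/
def prodState {H K : C} (φ : 𝟙_ C ⟶ H) (ψ : 𝟙_ C ⟶ K) : 𝟙_ C ⟶ H ⊗ K :=
  (λ_ (𝟙_ C)).inv ≫ (φ ⊗ₘ ψ)

/-- Classical (copyable) states of `A`. -/
def IsClassical (A : DaggerQSCFA H) (j : 𝟙_ C ⟶ H) : Prop :=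
  j ≫ A.comul = prodState j j

/-- Phase states of `A`: the multiplication applied to the conjugate of `φ` and to `φ` gives the
unit. The conjugate of `φ` is a state of the dual wire; bending that wire round turns the
multiplication into the comultiplication, with the effect `φ†` on one of its outputs. -/
def IsPhaseState (A : DaggerQSCFA H) (φ : 𝟙_ C ⟶ H) : Prop :=
  φ ≫ A.comul ≫ (φ† ▷ H) ≫ (λ_ H).hom = A.one

/-- The type of phase states of `A`. -/
def PhaseState (A : DaggerQSCFA H) : Type v := {φ : 𝟙_ C ⟶ H // A.IsPhaseState φ}

/-- The phase induced by a state: multiplication by it. -/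
def phaseMap (A : DaggerQSCFA H) (φ : 𝟙_ C ⟶ H) : H ⟶ H :=
  (λ_ H).inv ≫ (φ ▷ H) ≫ A.mul

/-- The sum of two states: their product under the multiplication of `A`. On phase states this is
the operation of the phase group. -/
def addState (A : DaggerQSCFA H) (φ ψ : 𝟙_ C ⟶ H) : 𝟙_ C ⟶ H :=
  prodState φ ψ ≫ A.mul

/-- The sum of `n` states. -/
def sumState (A : DaggerQSCFA H) : (n : ℕ) → (Fin n → (𝟙_ C ⟶ H)) → (𝟙_ C ⟶ H)
  | 0, _ => A.one
  | n + 1, φ => A.addState (φ 0) (A.sumState n (fun i => φ i.succ))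

/-- The comultiplication spider with one input and `n` outputs. -/
def copyTo (A : DaggerQSCFA H) : (n : ℕ) → (H ⟶ tpow H n)
  | 0 => A.counit
  | n + 1 => A.comul ≫ (H ◁ A.copyTo n)

/-- The `N`-partite GHZ state of `A`. -/
def ghz (A : DaggerQSCFA H) (N : ℕ) : 𝟙_ C ⟶ tpow H N :=
  A.one ≫ A.copyTo N

/-- Copy each of `n` wires once with the comultiplication. -/
def copyAll (A : DaggerQSCFA H) (n : ℕ) : tpow H n ⟶ tpow H n ⊗ tpow H n :=
  tensorHoms n (fun _ => A.comul) ≫ unzip H H n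

/-- The diagram in which the `r`-th input wire carries a comultiplication spider with one output
leg for every `s` such that `f s = r` (the counit if there is none), the leg for `s` being the
`s`-th output wire. -/
def wire (A : DaggerQSCFA H) (m : ℕ) : (n : ℕ) → (Fin n → Fin m) → (tpow H m ⟶ tpow H n)
  | 0, _ => discardAll A.counit m
  | n + 1, f => A.copyAll m ≫ (keepOne A.counit m (f 0) ⊗ₘ A.wire m n (fun s => f s.succ))

end DaggerQSCFA

open DaggerQSCFA

variable {H : C}

/-- Strongly complementary pairs: the bialgebra equation and the coherence equations. -/
structure StronglyComplementary (Z X : DaggerQSCFA H) : Prop where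
  bialgebra : X.mul ≫ Z.comul =
    (Z.comul ⊗ₘ Z.comul) ≫ tensorμ H H H H ≫ (X.mul ⊗ₘ X.mul)
  unit_copy : X.one ≫ Z.comul = prodState X.one X.one
  counit_copy : X.mul ≫ Z.counit = (Z.counit ⊗ₘ Z.counit) ≫ (λ_ (𝟙_ C)).hom

/-- Apply the `Z`-phases `φ₁, …, φ_N` to the components of the `N`-partite GHZ state. -/
def phasedGHZ (Z : DaggerQSCFA H) {N : ℕ} (φ : Fin N → (𝟙_ C ⟶ H)) : 𝟙_ C ⟶ tpow H N :=
  Z.ghz N ≫ tensorHoms N (fun i => Z.phaseMap (φ i))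

/-- The state obtained from the `N`-partite state `ψ` by measuring each component in the structure
`X`: each component of `ψ` and of its conjugate enter an `X`-node with one output. The conjugate
wires are bent round, so that each `X`-node becomes the comultiplication of `X`, one of its outputs
being the outcome and the other one entering the effect `ψ†`. -/
def measureIn (X : DaggerQSCFA H) {N : ℕ} (ψ : 𝟙_ C ⟶ tpow H N) : 𝟙_ C ⟶ tpow H N :=
  ψ ≫ X.copyAll N ≫ (tpow H N ◁ ψ†) ≫ (ρ_ (tpow H N)).hom

/-- A Mermin measurement scenario for `(Z, X)`: `S ≥ 1` measurements on `N` parties, in which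
exactly the distinct `Z`-phases `a₁, …, a_M` appear. Measurement `s` applies to component `i` the
phase `a_r` with `r = setting s i`; the sum of the phases in each measurement is `X`-classical. -/
structure MerminScenario (Z X : DaggerQSCFA H) where
  N : ℕ
  S : ℕ
  M : ℕ
  S_pos : 0 < S
  a : Fin M → Z.PhaseState
  a_injective : Function.Injective a
  setting : Fin S → Fin N → Fin M
  appears : ∀ r : Fin M, ∃ s i, setting s i = r
  sum_classical : ∀ s : Fin S, X.IsClassical (Z.sumState N (fun i => (a (setting s i)).1))

namespace MerminScenario

variable {Z X : DaggerQSCFA H} (σ : MerminScenario Z X)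

/-- The Mermin measurement with index `s` of the scenario. -/
def measurement (s : Fin σ.S) : 𝟙_ C ⟶ tpow H σ.N :=
  measureIn X (phasedGHZ Z (fun i => (σ.a (σ.setting s i)).1))

/-- The local map: the inputs are `N` groups (systems) of `M` wires, the outputs are `S` groups
(measurements) of `N` wires; the `X`-node on the `r`-th input wire for system `i` is connected to
the `j`-th output wire for measurement `s` if and only if `i = j` and `setting s j = r`. -/
def localMap : tpow (tpow H σ.M) σ.N ⟶ tpow (tpow H σ.N) σ.S :=
  tensorHoms σ.N (fun i => X.wire σ.M σ.S (fun s => σ.setting s i)) ≫ regroup H σ.N σ.S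

/-- The scenario admits a local hidden variable model: a state `l` such that, for every `s`,
applying the local map and then the counit of `X` to each output wire of every other measurement
gives the Mermin measurement `s`. -/
def HasLHVModel : Prop :=
  ∃ l : 𝟙_ C ⟶ tpow (tpow H σ.M) σ.N, ∀ s : Fin σ.S,
    σ.measurement s =
      l ≫ σ.localMap ≫ keepOne (discardAll X.counit σ.N) σ.S s

end MerminScenario

end Mermin

/-- Mermin non-locality: some Mermin scenario, for some strongly complementary pair, has no local
hidden variable model. -/
def MerminNonlocal (C : Type u) [Category.{v} C] [MonoidalCategory C] [SymmetricCategory C]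
    [DaggerSMC C] : Prop :=
  ∃ (H : C) (Z X : DaggerQSCFA H), StronglyComplementary Z X ∧
    ∃ σ : MerminScenario Z X, ¬ σ.HasLHVModel

/-- Mermin locality. -/
def MerminLocal (C : Type u) [Category.{v} C] [MonoidalCategory C] [SymmetricCategory C]
    [DaggerSMC C] : Prop :=
  ¬ MerminNonlocal C

/-- `G` is a non-trivial algebraic extension of its subgroup `K`: some finite system of integer
linear equations with right hand sides in `K` is solvable in `G` but not in `K`. -/
def IsNontrivialAlgebraicExtension {G : Type*} [AddCommGroup G] (K : AddSubgroup G) : Prop :=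
  ∃ (k l : ℕ) (n : Fin k → Fin l → ℤ) (h : Fin k → G), (∀ p, h p ∈ K) ∧
    (∃ x : Fin l → G, ∀ p, ∑ j, n p j • x j = h p) ∧
    ¬ ∃ x : Fin l → G, (∀ j, x j ∈ K) ∧ ∀ p, ∑ j, n p j • x j = h p

/-! ## Spekkens' toy theory -/

/-- The objects of the toy theory: the one-element set `I`, the four-element set `IV`, and their
iterated Cartesian products. -/
inductive Spek : Type
  | I : Spek
  | IV : Spek
  | prod : Spek → Spek → Spek

namespace Spek

/-- The underlying finite set of an object. The elements of `IV` are numbered from `0`. -/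
@[reducible] def carrier : Spek → Type
  | I => Unit
  | IV => Fin 4
  | prod A B => A.carrier × B.carrier

/-- The copying relation: `0 ~ {00, 11}`, `1 ~ {01, 10}`, `2 ~ {22, 33}`, `3 ~ {23, 32}`. -/
def copyRel (x : Fin 4) (y : Fin 4 × Fin 4) : Prop :=
  (x, y) ∈ ([(0, 0, 0), (0, 1, 1), (1, 0, 1), (1, 1, 0),
    (2, 2, 2), (2, 3, 3), (3, 2, 3), (3, 3, 2)] : List (Fin 4 × Fin 4 × Fin 4))

/-- The deleting relation `{0, 2} ~ *`. -/
def deleteRel (x : Fin 4) (_ : Unit) : Prop := x = 0 ∨ x = 2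

/-- The relations of the toy theory: those generated under composition, Cartesian product and
relational converse by the permutations of `IV`, the copying and deleting relations, and the
structural bijections. -/
inductive IsSpek : {A B : Spek} → (A.carrier → B.carrier → Prop) → Prop
  | perm (σ : Equiv.Perm (Fin 4)) : @IsSpek IV IV (fun x y => y = σ x)
  | copy : @IsSpek IV (prod IV IV) copyRel
  | delete : @IsSpek IV I deleteRel
  | id (A : Spek) : @IsSpek A A (fun x y => y = x)
  | assoc (A B D : Spek) : @IsSpek (prod (prod A B) D) (prod A (prod B D))
      (fun x y => y = (x.1.1, x.1.2, x.2))
  | leftUnit (A : Spek) : @IsSpek (prod I A) A (fun x y => y = x.2)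
  | rightUnit (A : Spek) : @IsSpek (prod A I) A (fun x y => y = x.1)
  | swap (A B : Spek) : @IsSpek (prod A B) (prod B A) (fun x y => y = (x.2, x.1))
  | comp {A B D : Spek} {r : A.carrier → B.carrier → Prop} {s : B.carrier → D.carrier → Prop} :
      IsSpek r → IsSpek s → @IsSpek A D (fun x z => ∃ y, r x y ∧ s y z)
  | tensor {A B A' B' : Spek} {r : A.carrier → B.carrier → Prop}
      {s : A'.carrier → B'.carrier → Prop} :
      IsSpek r → IsSpek s →
        @IsSpek (prod A A') (prod B B') (fun x y => r x.1 y.1 ∧ s x.2 y.2)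
  | converse {A B : Spek} {r : A.carrier → B.carrier → Prop} :
      IsSpek r → @IsSpek B A (fun y x => r x y)

/-- A morphism of the toy theory. -/
@[ext] structure Hom (A B : Spek) : Type where
  rel : A.carrier → B.carrier → Prop
  isSpek : IsSpek rel

instance : Category Spek where
  Hom := Hom
  id A := ⟨_, .id A⟩
  comp f g := ⟨_, .comp f.isSpek g.isSpek⟩
  id_comp f := by ext; simp
  comp_id f := by ext; simp
  assoc f g h := by
    ext x y
    exact ⟨fun ⟨c, ⟨b, h1, h2⟩, h3⟩ => ⟨b, h1, c, h2, h3⟩,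
      fun ⟨b, h1, c, h2, h3⟩ => ⟨c, ⟨b, h1, h2⟩, h3⟩⟩

@[ext] theorem hom_ext {A B : Spek} {f g : A ⟶ B} (h : ∀ x y, f.rel x y ↔ g.rel x y) : f = g :=
  Hom.ext (funext fun x => funext fun y => propext (h x y))

theorem id_rel (A : Spek) (x y : A.carrier) : (𝟙 A : A ⟶ A).rel x y ↔ y = x := Iff.rfl

theorem comp_rel {A B D : Spek} (f : A ⟶ B) (g : B ⟶ D) (x : A.carrier) (z : D.carrier) :
    (f ≫ g).rel x z ↔ ∃ y, f.rel x y ∧ g.rel y z := Iff.rfl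

/-- The Cartesian product of two morphisms. -/
def tensorHom {A B A' B' : Spek} (f : A ⟶ B) (g : A' ⟶ B') : prod A A' ⟶ prod B B' :=
  ⟨_, .tensor f.isSpek g.isSpek⟩

theorem tensorHom_rel {A B A' B' : Spek} (f : A ⟶ B) (g : A' ⟶ B') (x : A.carrier × A'.carrier)
    (y : B.carrier × B'.carrier) :
    (tensorHom f g).rel x y ↔ f.rel x.1 y.1 ∧ g.rel x.2 y.2 := Iff.rfl

/-- The relational converse. -/
def converse {A B : Spek} (f : A ⟶ B) : B ⟶ A := ⟨_, .converse f.isSpek⟩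

theorem converse_rel {A B : Spek} (f : A ⟶ B) (x : A.carrier) (y : B.carrier) :
    (converse f).rel y x ↔ f.rel x y := Iff.rfl

/-- A bijection whose graph is a morphism, as an isomorphism. -/
def graphIso {A B : Spek} (e : A.carrier ≃ B.carrier)
    (h : @IsSpek A B (fun x y => y = e x)) : A ≅ B where
  hom := ⟨_, h⟩
  inv := ⟨_, .converse h⟩
  hom_inv_id := by ext x y; simp [comp_rel, id_rel, eq_comm]
  inv_hom_id := by
    ext x y
    simp only [comp_rel, id_rel]
    exact ⟨fun ⟨a, h1, h2⟩ => h2.trans h1.symm, fun h => ⟨e.symm x, by simp, by simp [h]⟩⟩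

/-- The associativity bijection. -/
def assocIso (A B D : Spek) : prod (prod A B) D ≅ prod A (prod B D) :=
  graphIso (Equiv.prodAssoc _ _ _) (.assoc A B D)

/-- The left unit bijection. -/
def leftIso (A : Spek) : prod I A ≅ A := graphIso (Equiv.punitProd _) (.leftUnit A)

/-- The right unit bijection. -/
def rightIso (A : Spek) : prod A I ≅ A := graphIso (Equiv.prodPUnit _) (.rightUnit A)

/-- The symmetry bijection. -/
def swapIso (A B : Spek) : prod A B ≅ prod B A := graphIso (Equiv.prodComm _ _) (.swap A B)

theorem assocIso_hom_rel (A B D : Spek) (x : (A.carrier × B.carrier) × D.carrier)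
    (y : A.carrier × B.carrier × D.carrier) :
    (assocIso A B D).hom.rel x y ↔ y = (x.1.1, x.1.2, x.2) := Iff.rfl

theorem assocIso_inv_rel (A B D : Spek) (x : (A.carrier × B.carrier) × D.carrier)
    (y : A.carrier × B.carrier × D.carrier) :
    (assocIso A B D).inv.rel y x ↔ y = (x.1.1, x.1.2, x.2) := Iff.rfl

theorem leftIso_hom_rel (A : Spek) (x : Unit × A.carrier) (y : A.carrier) :
    (leftIso A).hom.rel x y ↔ y = x.2 := Iff.rfl

theorem rightIso_hom_rel (A : Spek) (x : A.carrier × Unit) (y : A.carrier) :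
    (rightIso A).hom.rel x y ↔ y = x.1 := Iff.rfl

theorem swapIso_hom_rel (A B : Spek) (x : A.carrier × B.carrier) (y : B.carrier × A.carrier) :
    (swapIso A B).hom.rel x y ↔ y = (x.2, x.1) := Iff.rfl

instance : MonoidalCategory Spek where
  tensorObj := prod
  tensorUnit := I
  tensorHom := tensorHom
  whiskerLeft A _ _ f := tensorHom (𝟙 A) f
  whiskerRight f A := tensorHom f (𝟙 A)
  associator := assocIso
  leftUnitor := leftIso
  rightUnitor := rightIso
  id_tensorHom_id A B := by
    ext ⟨x, x'⟩ ⟨y, y'⟩; simp [tensorHom_rel, id_rel]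
  whiskerLeft_id A B := by
    ext ⟨x, x'⟩ ⟨y, y'⟩; simp [tensorHom_rel, id_rel]
  id_whiskerRight A B := by
    ext ⟨x, x'⟩ ⟨y, y'⟩; simp [tensorHom_rel, id_rel]
  tensorHom_comp_tensorHom f g f' g' := by
    ext ⟨x, x'⟩ ⟨y, y'⟩; simp only [tensorHom_rel, comp_rel, Prod.exists]; grind
  tensorHom_def f g := by
    ext ⟨x, x'⟩ ⟨y, y'⟩; simp [tensorHom_rel, comp_rel, id_rel]
  associator_naturality f g h := by
    ext ⟨⟨x, x'⟩, x''⟩ ⟨y, y', y''⟩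
    simp [tensorHom_rel, comp_rel, assocIso_hom_rel, and_assoc]
  leftUnitor_naturality f := by
    ext ⟨x, x'⟩ y; simp [tensorHom_rel, comp_rel, id_rel, leftIso_hom_rel]
  rightUnitor_naturality f := by
    ext ⟨x, x'⟩ y; simp [tensorHom_rel, comp_rel, id_rel, rightIso_hom_rel]
  pentagon A B D E := by
    ext ⟨⟨⟨x, x'⟩, x''⟩, x'''⟩ ⟨y, y', y'', y'''⟩
    simp [tensorHom_rel, comp_rel, id_rel, assocIso_hom_rel]
  triangle A B := by
    ext ⟨⟨x, x'⟩, x''⟩ ⟨y, y'⟩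
    simp [tensorHom_rel, comp_rel, id_rel, assocIso_hom_rel, leftIso_hom_rel, rightIso_hom_rel]

theorem swap_naturality {A B A' B' : Spek} (f : A ⟶ B) (g : A' ⟶ B') :
    tensorHom f g ≫ (swapIso B B').hom = (swapIso A A').hom ≫ tensorHom g f := by
  ext ⟨x, x'⟩ ⟨y, y'⟩
  simp [comp_rel, tensorHom_rel, swapIso_hom_rel, and_comm]

theorem hexagon_forward (A B D : Spek) :
    (assocIso A B D).hom ≫ (swapIso A (prod B D)).hom ≫ (assocIso B D A).hom =
      tensorHom (swapIso A B).hom (𝟙 D) ≫ (assocIso B A D).hom ≫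
        tensorHom (𝟙 B) (swapIso A D).hom := by
  ext ⟨⟨x, x'⟩, x''⟩ ⟨y, y', y''⟩
  simp [comp_rel, tensorHom_rel, swapIso_hom_rel, assocIso_hom_rel, id_rel]

theorem hexagon_reverse (A B D : Spek) :
    (assocIso A B D).inv ≫ (swapIso (prod A B) D).hom ≫ (assocIso D A B).inv =
      tensorHom (𝟙 A) (swapIso B D).hom ≫ (assocIso A D B).inv ≫
        tensorHom (swapIso A D).hom (𝟙 B) := by
  ext ⟨x, x', x''⟩ ⟨⟨y, y'⟩, y''⟩
  simp [comp_rel, tensorHom_rel, swapIso_hom_rel, assocIso_inv_rel, id_rel]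
  grind

theorem swap_swap (A B : Spek) : (swapIso A B).hom ≫ (swapIso B A).hom = 𝟙 (prod A B) := by
  ext ⟨x, x'⟩ ⟨y, y'⟩
  simp [comp_rel, swapIso_hom_rel, id_rel]

theorem tensor_rel {A B A' B' : Spek} (f : A ⟶ B) (g : A' ⟶ B') (x : A.carrier × A'.carrier)
    (y : B.carrier × B'.carrier) : (f ⊗ₘ g).rel x y ↔ f.rel x.1 y.1 ∧ g.rel x.2 y.2 := Iff.rfl

theorem whiskerLeft_rel (A : Spek) {B D : Spek} (f : B ⟶ D) (x : A.carrier × B.carrier)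
    (y : A.carrier × D.carrier) : (A ◁ f).rel x y ↔ y.1 = x.1 ∧ f.rel x.2 y.2 := Iff.rfl

theorem whiskerRight_rel {B D : Spek} (f : B ⟶ D) (A : Spek) (x : B.carrier × A.carrier)
    (y : D.carrier × A.carrier) : (f ▷ A).rel x y ↔ f.rel x.1 y.1 ∧ y.2 = x.2 := Iff.rfl

theorem associator_hom_rel (A B D : Spek) (x : (A.carrier × B.carrier) × D.carrier)
    (y : A.carrier × B.carrier × D.carrier) :
    (α_ A B D).hom.rel x y ↔ y = (x.1.1, x.1.2, x.2) := Iff.rfl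

theorem associator_inv_rel (A B D : Spek) (x : (A.carrier × B.carrier) × D.carrier)
    (y : A.carrier × B.carrier × D.carrier) :
    (α_ A B D).inv.rel y x ↔ y = (x.1.1, x.1.2, x.2) := Iff.rfl

theorem leftUnitor_hom_rel (A : Spek) (x : Unit × A.carrier) (y : A.carrier) :
    (λ_ A).hom.rel x y ↔ y = x.2 := Iff.rfl

theorem leftUnitor_inv_rel (A : Spek) (x : Unit × A.carrier) (y : A.carrier) :
    (λ_ A).inv.rel y x ↔ y = x.2 := Iff.rfl

theorem rightUnitor_hom_rel (A : Spek) (x : A.carrier × Unit) (y : A.carrier) :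
    (ρ_ A).hom.rel x y ↔ y = x.1 := Iff.rfl

theorem rightUnitor_inv_rel (A : Spek) (x : A.carrier × Unit) (y : A.carrier) :
    (ρ_ A).inv.rel y x ↔ y = x.1 := Iff.rfl

instance : SymmetricCategory Spek where
  braiding := swapIso
  braiding_naturality_right A _ _ f := swap_naturality (𝟙 A) f
  braiding_naturality_left f A := swap_naturality f (𝟙 A)
  hexagon_forward := hexagon_forward
  hexagon_reverse := hexagon_reverse
  symmetry := swap_swap

theorem braiding_hom_rel (A B : Spek) (x : A.carrier × B.carrier) (y : B.carrier × A.carrier) :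
    (β_ A B).hom.rel x y ↔ y = (x.2, x.1) := Iff.rfl

instance : DaggerSMC Spek where
  dagger := converse
  dagger_id A := by ext x y; simp [converse_rel, id_rel, eq_comm]
  dagger_comp f g := by ext x y; simp [converse_rel, comp_rel, and_comm]
  dagger_dagger f := rfl
  dagger_tensor f g := rfl
  dagger_associator A B D := rfl
  dagger_leftUnitor A := rfl
  dagger_rightUnitor A := rfl
  dagger_braiding A B := rfl


instance (x : Fin 4) (y : Fin 4 × Fin 4) : Decidable (copyRel x y) :=
  inferInstanceAs (Decidable (_ ∈ _))

instance (x : Fin 4) (y : Unit) : Decidable (deleteRel x y) :=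
  inferInstanceAs (Decidable (_ ∨ _))

/-- A permutation of `IV` as a morphism. -/
def permHom (σ : Equiv.Perm (Fin 4)) : IV ⟶ IV := ⟨_, .perm σ⟩

/-- The copying relation as a morphism. -/
def copyHom : IV ⟶ IV ⊗ IV := ⟨_, .copy⟩

/-- The deleting relation as a morphism. -/
def deleteHom : IV ⟶ 𝟙_ Spek := ⟨_, .delete⟩

/-- The image of the copying relation under a permutation of `IV`. -/
def copyHomOf (σ : Equiv.Perm (Fin 4)) : IV ⟶ IV ⊗ IV :=
  permHom σ⁻¹ ≫ copyHom ≫ (permHom σ ⊗ₘ permHom σ)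

/-- The image of the deleting relation under a permutation of `IV`. -/
def deleteHomOf (σ : Equiv.Perm (Fin 4)) : IV ⟶ 𝟙_ Spek :=
  permHom σ⁻¹ ≫ deleteHom

theorem copyHomOf_rel (σ : Equiv.Perm (Fin 4)) (x : Fin 4) (y : Fin 4 × Fin 4) :
    (copyHomOf σ).rel x y ↔ copyRel (σ⁻¹ x) (σ⁻¹ y.1, σ⁻¹ y.2) := by
  constructor
  · rintro ⟨a, ha, b, hb, h1, h2⟩
    change a = _ at ha
    change y.1 = _ at h1
    change y.2 = _ at h2
    subst ha
    rw [h1, h2]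
    simp only [Equiv.Perm.inv_def, Equiv.symm_apply_apply]
    exact hb
  · intro h
    exact ⟨_, rfl, _, h, (σ.apply_symm_apply _).symm, (σ.apply_symm_apply _).symm⟩

theorem deleteHomOf_rel (σ : Equiv.Perm (Fin 4)) (x : Fin 4) (y : Unit) :
    (deleteHomOf σ).rel x y ↔ deleteRel (σ⁻¹ x) y := by
  constructor
  · rintro ⟨a, ha, h⟩
    change a = _ at ha
    subst ha
    exact h
  · intro h
    exact ⟨_, rfl, h⟩

theorem dagger_rel {A B : Spek} (f : A ⟶ B) (x : A.carrier) (y : B.carrier) :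
    (f†).rel y x ↔ f.rel x y := Iff.rfl

theorem exists_inv (σ : Equiv.Perm (Fin 4)) (p : Fin 4 → Prop) :
    (∃ u, p (σ⁻¹ u)) ↔ ∃ u, p u :=
  ⟨fun ⟨u, h⟩ => ⟨_, h⟩, fun ⟨u, h⟩ => ⟨σ u, by simpa using h⟩⟩

theorem comul_counit_aux : ∀ x z : Fin 4,
    (∃ y, copyRel x (z, y) ∧ deleteRel y ()) ↔ x = z := by decide

theorem copy_comm_aux : ∀ x y z : Fin 4, copyRel x (y, z) ↔ copyRel x (z, y) := by decide

set_option maxRecDepth 10000 in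
theorem copy_assoc_aux : ∀ x y z w : Fin 4, (∃ u, copyRel x (y, u) ∧ copyRel u (z, w)) ↔
    ∃ u, copyRel x (u, w) ∧ copyRel u (y, z) := by decide

set_option maxRecDepth 10000 in
theorem frobenius_aux : ∀ x y z w : Fin 4, (∃ u, copyRel y (u, w) ∧ copyRel z (x, u)) ↔
    ∃ u, copyRel u (x, y) ∧ copyRel u (z, w) := by decide

set_option maxRecDepth 10000 in
theorem special_aux : ∀ x w : Fin 4, (∃ y z, copyRel x (y, z) ∧ copyRel w (y, z)) ↔ x = w := by
  decide

theorem exists_tensor {A B : Spek} (p : (A ⊗ B).carrier → Prop) :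
    (∃ x, p x) ↔ ∃ (a : A.carrier) (b : B.carrier), p (a, b) :=
  ⟨fun ⟨(a, b), h⟩ => ⟨a, b, h⟩, fun ⟨a, b, h⟩ => ⟨(a, b), h⟩⟩

/-- The image of the observable `(copyHom, deleteHom)` under a permutation of `IV`. -/
def observable (σ : Equiv.Perm (Fin 4)) : DaggerQSCFA IV where
  counit := deleteHomOf σ
  comul := copyHomOf σ
  counit_comul := by
    ext (x : Fin 4) ⟨⟨⟩, (y : Fin 4)⟩
    have h := comul_counit_aux (σ⁻¹ x) (σ⁻¹ y)
    rw [← exists_inv σ (fun u => copyRel (σ⁻¹ x) (σ⁻¹ y, u) ∧ deleteRel u ())] at h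
    simp only [copy_comm_aux _ (σ⁻¹ y)] at h
    simp only [comp_rel, exists_tensor, whiskerRight_rel, leftUnitor_inv_rel, copyHomOf_rel,
      deleteHomOf_rel]
    simpa using h
  comul_counit := by
    ext (x : Fin 4) ⟨(y : Fin 4), ⟨⟩⟩
    have h := comul_counit_aux (σ⁻¹ x) (σ⁻¹ y)
    rw [← exists_inv σ (fun u => copyRel (σ⁻¹ x) (σ⁻¹ y, u) ∧ deleteRel u ())] at h
    simp only [comp_rel, exists_tensor, whiskerLeft_rel, rightUnitor_inv_rel, copyHomOf_rel, deleteHomOf_rel]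
    simpa using h
  comul_assoc := by
    ext (x : Fin 4) ⟨(y : Fin 4), (z : Fin 4), (w : Fin 4)⟩
    have h := copy_assoc_aux (σ⁻¹ x) (σ⁻¹ y) (σ⁻¹ z) (σ⁻¹ w)
    rw [← exists_inv σ (fun u => copyRel (σ⁻¹ x) (σ⁻¹ y, u) ∧ copyRel u _),
      ← exists_inv σ (fun u => copyRel (σ⁻¹ x) (u, σ⁻¹ w) ∧ copyRel u _)] at h
    simp only [comp_rel, exists_tensor, whiskerLeft_rel, whiskerRight_rel, associator_hom_rel,
      copyHomOf_rel, Prod.mk.injEq]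
    constructor
    · rintro ⟨_, d, h1, rfl, h2⟩
      obtain ⟨u, h3, h4⟩ := h.1 ⟨d, h1, h2⟩
      exact ⟨u, w, h3, y, z, w, ⟨h4, rfl⟩, rfl, rfl⟩
    · rintro ⟨u, _, h3, _, _, _, ⟨h4, rfl⟩, rfl, h5⟩
      cases h5
      obtain ⟨d, h1, h2⟩ := h.2 ⟨u, h3, h4⟩
      exact ⟨y, d, h1, rfl, h2⟩
  comul_comm := by
    ext (x : Fin 4) ⟨(y : Fin 4), (z : Fin 4)⟩
    simp only [comp_rel, exists_tensor, braiding_hom_rel, copyHomOf_rel]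
    simpa using copy_comm_aux _ _ _
  frobenius_left := by
    ext ⟨(x : Fin 4), (y : Fin 4)⟩ ⟨(z : Fin 4), (w : Fin 4)⟩
    have h := frobenius_aux (σ⁻¹ x) (σ⁻¹ y) (σ⁻¹ z) (σ⁻¹ w)
    rw [← exists_inv σ (fun u => copyRel _ (u, σ⁻¹ w) ∧ _),
      ← exists_inv σ (fun u => copyRel u (σ⁻¹ x, _) ∧ _)] at h
    simp only [comp_rel, exists_tensor, whiskerLeft_rel, whiskerRight_rel, associator_inv_rel,
      copyHomOf_rel, dagger_rel, Prod.mk.injEq]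
    refine Iff.trans ?_ h
    constructor
    · rintro ⟨_, _, _, ⟨rfl, h1⟩, u, _, _, ⟨rfl, h5⟩, h2, rfl⟩
      cases h5
      exact ⟨_, h1, h2⟩
    · rintro ⟨u, h1, h2⟩
      exact ⟨x, u, w, ⟨rfl, h1⟩, x, u, w, ⟨rfl, rfl⟩, h2, rfl⟩
  frobenius_right := by
    ext ⟨(x : Fin 4), (y : Fin 4)⟩ ⟨(z : Fin 4), (w : Fin 4)⟩
    have h := frobenius_aux (σ⁻¹ y) (σ⁻¹ x) (σ⁻¹ w) (σ⁻¹ z)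
    rw [← exists_inv σ (fun u => copyRel _ (u, σ⁻¹ z) ∧ _),
      ← exists_inv σ (fun u => copyRel u (σ⁻¹ y, _) ∧ _)] at h
    simp only [comp_rel, exists_tensor, whiskerLeft_rel, whiskerRight_rel, associator_hom_rel,
      copyHomOf_rel, dagger_rel, Prod.mk.injEq]
    simp only [copy_comm_aux _ (σ⁻¹ y), copy_comm_aux _ (σ⁻¹ w), copy_comm_aux _ _ (σ⁻¹ z)] at h
    refine Iff.trans ?_ h
    constructor
    · rintro ⟨_, _, _, ⟨h1, rfl⟩, u, _, _, ⟨rfl, h5⟩, rfl, h2⟩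
      cases h5
      exact ⟨_, h1, h2⟩
    · rintro ⟨u, h1, h2⟩
      exact ⟨z, u, y, ⟨h1, rfl⟩, z, u, y, ⟨rfl, rfl⟩, rfl, h2⟩
  quasiSpecial := by
    refine ⟨Iso.refl _, ?_⟩
    ext (x : Fin 4) (w : Fin 4)
    simp only [Iso.refl_hom, id_whiskerRight, Category.id_comp, Iso.inv_hom_id, id_rel,
      comp_rel, exists_tensor, copyHomOf_rel, dagger_rel]
    constructor
    · rintro ⟨y, z, h1, h2⟩
      exact (σ⁻¹.injective ((special_aux _ _).1 ⟨_, _, h1, h2⟩)).symm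
    · rintro rfl
      obtain ⟨y, z, h⟩ := (special_aux (σ⁻¹ w) (σ⁻¹ w)).2 rfl
      exact ⟨σ y, σ z, by simpa using h⟩

/-- The observable `Z` of the toy bit: copying and deleting as in the generating relations. -/
def Z : DaggerQSCFA IV := observable 1

/-- The observable `X` of the toy bit: the image of `Z` under the transposition of the two middle
elements of `IV`. -/
def X : DaggerQSCFA IV := observable (Equiv.swap 1 2)

end Spek

/-! Locality must hold for every strongly complementary pair on every object, so a computation on
the toy bit does not suffice. The uniform reason is that all relations of the toy theory are closed
under the affine operation x + y + z over the two-element field (`IsSpek.affine`). Together with the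
counit law this makes every comultiplication symmetric under exchanging its input with an output
(`comul_rotate`), and therefore every phase state of every observable has order two.

States of order two form an abelian group of exponent two, that is, a vector space over the
two-element field, in which the classical states are a subspace. Such a subspace has a linear
retraction. The retraction carries solutions of integer equations back into the subspace, which
gives triviality of the extension.

The same retraction gives locality. A phased GHZ state depends only on the sum of its phases
(`phasedGHZ_eq`), and that sum is classical, hence fixed by the retraction; so every phase of a
scenario may be replaced by its classical image. Classical phases commute with the measurement
(`measureIn_phasedGHZ`). A hidden variable model is then obtained by measuring the plain GHZ state,
copying each outcome once for every phase of the scenario, and applying the classical image of that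
phase to its copy. Discarding the other copies absorbs their phases
(`phaseMap_counit_of_isClassical`).

The claims about the specific pair are finite checks on subsets of a four-element set. -/

/-! ## Algebraic extensions of exponent two -/

/-- A subgroup of an abelian group of exponent two is a retract. -/
theorem exists_retraction_of_add_self {G : Type*} [AddCommGroup G] (h2 : ∀ g : G, g + g = 0)
    (K : AddSubgroup G) : ∃ π : G →+ G, (∀ g, π g ∈ K) ∧ ∀ g ∈ K, π g = g := by
  -- Over the field `ZMod 2` the inclusion of a subspace splits.
  let : Module (ZMod 2) G := AddCommGroup.zmodModule (fun g => by rw [two_nsmul, h2])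
  obtain ⟨π, hπ⟩ := (AddSubgroup.toZModSubmodule 2 K).subtype.exists_leftInverse_of_injective
    (LinearMap.ker_eq_bot.2 Subtype.val_injective)
  refine ⟨((AddSubgroup.toZModSubmodule 2 K).subtype ∘ₗ π).toAddMonoidHom,
    fun g => (π g).2, fun g hg => ?_⟩
  exact congrArg Subtype.val (LinearMap.congr_fun hπ ⟨g, hg⟩)

/-- An abelian group of exponent two is a trivial algebraic extension of each of its subgroups. -/
theorem not_isNontrivialAlgebraicExtension_of_add_self {G : Type*} [AddCommGroup G]
    (h2 : ∀ g : G, g + g = 0) (K : AddSubgroup G) : ¬ IsNontrivialAlgebraicExtension K := by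
  rintro ⟨k, l, n, h, hK, ⟨x, hx⟩, hno⟩
  obtain ⟨π, hπ, hπK⟩ := exists_retraction_of_add_self h2 K
  -- The retraction of a solution is a solution, because the right-hand sides are fixed.
  refine hno ⟨fun j => π (x j), fun j => hπ _, fun p => ?_⟩
  rw [← hπK _ (hK p), ← hx p, map_sum]
  simp only [map_zsmul]

namespace Spek

open DaggerQSCFA

/-! ## The affine structure of the objects -/

theorem nonempty_carrier : ∀ A : Spek, Nonempty A.carrier
  | I => ⟨()⟩
  | IV => ⟨(0 : Fin 4)⟩
  | prod A B => (nonempty_carrier A).elim fun x => (nonempty_carrier B).elim fun y => ⟨(x, y)⟩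

/-- The ternary operation `x + y + z` of the affine plane over the two-element field with underlying
set `IV`: three distinct points are sent to the fourth. -/
def affine4 (x y z : Fin 4) : Fin 4 :=
  -- The elements of `Fin 4` sum to 6 = 2, so `2 - x - y - z` is the remaining point when the three
  -- are distinct.
  if x = y then z else if y = z then x else if x = z then y else 2 - x - y - z

/-- The ternary operation `x + y + z` of the affine space over the two-element field underlying
an object. -/
def affine : (A : Spek) → A.carrier → A.carrier → A.carrier → A.carrier
  | I, _, _, _ => ()
  | IV, x, y, z => affine4 x y z
  | prod A B, x, y, z => (affine A x.1 y.1 z.1, affine B x.2 y.2 z.2)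

/-- In characteristic two a repeated argument cancels, whichever two positions it occupies. -/
theorem affine_self_left : ∀ (A : Spek) (x z : A.carrier), affine A x x z = z
  | I, _, _ => rfl
  | IV, x, z => (by decide : ∀ x z : Fin 4, affine4 x x z = z) x z
  | prod A B, x, z => Prod.ext (affine_self_left A _ _) (affine_self_left B _ _)

theorem affine_self_right : ∀ (A : Spek) (x z : A.carrier), affine A z x x = z
  | I, _, _ => rfl
  | IV, x, z => (by decide : ∀ x z : Fin 4, affine4 z x x = z) x z
  | prod A B, x, z => Prod.ext (affine_self_right A _ _) (affine_self_right B _ _)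

theorem affine_self_outer : ∀ (A : Spek) (x z : A.carrier), affine A x z x = z
  | I, _, _ => rfl
  | IV, x, z => (by decide : ∀ x z : Fin 4, affine4 x z x = z) x z
  | prod A B, x, z => Prod.ext (affine_self_outer A _ _) (affine_self_outer B _ _)

theorem affine_affine_swap : ∀ (A : Spek) (x y z : A.carrier),
    affine A (affine A x y z) z y = x
  | I, _, _, _ => rfl
  | IV, x, y, z => (by decide : ∀ x y z : Fin 4, affine4 (affine4 x y z) z y = x) x y z
  | prod A B, x, y, z => Prod.ext (affine_affine_swap A _ _ _) (affine_affine_swap B _ _ _)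

theorem affine4_of_ne : ∀ x y z w : Fin 4, x ≠ y ∧ x ≠ z ∧ x ≠ w ∧ y ≠ z ∧ y ≠ w ∧ z ≠ w →
    affine4 x y z = w := by
  decide

theorem affine4_ne : ∀ x y z : Fin 4, x ≠ y → x ≠ z → y ≠ z →
    affine4 x y z ≠ x ∧ affine4 x y z ≠ y ∧ affine4 x y z ≠ z := by
  decide

/-- Every permutation of a four-point plane is affine: the sum of three distinct points is
characterised as the point different from all of them. -/
theorem affine_perm (σ : Equiv.Perm (Fin 4)) (x y z : Fin 4) :
    affine4 (σ x) (σ y) (σ z) = σ (affine4 x y z) := by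
  by_cases hxy : x = y
  · subst hxy; simp [affine4]
  by_cases hyz : y = z
  · subst hyz; simp [affine4, hxy]
  by_cases hxz : x = z
  · subst hxz; simp only [affine4, if_true, σ.injective.eq_iff]; split_ifs; simp_all
  obtain ⟨h1, h2, h3⟩ := affine4_ne x y z hxy hxz hyz
  exact affine4_of_ne _ _ _ _ ⟨σ.injective.ne hxy, σ.injective.ne hxz, σ.injective.ne h1.symm,
    σ.injective.ne hyz, σ.injective.ne h2.symm, σ.injective.ne h3.symm⟩

/-- The two coordinates of the points of `IV`. -/
def coord (x : Fin 4) : ZMod 2 × ZMod 2 := ![(0, 0), (0, 1), (1, 0), (1, 1)] x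

/-- Exhibits copying as the solution set of linear equations: the first coordinate is copied, while
the second is split as a sum. -/
theorem copyRel_iff_coord : ∀ x y z : Fin 4,
    copyRel x (y, z) ↔ (coord x).1 = (coord y).1 ∧ (coord x).1 = (coord z).1 ∧
      (coord x).2 = (coord y).2 + (coord z).2 := by
  decide

theorem coord_affine4 : ∀ x y z : Fin 4, coord (affine4 x y z) = coord x + coord y + coord z := by
  decide

theorem copyRel_affine (x x' x'' y y' y'' z z' z'' : Fin 4) (h : copyRel x (y, z))
    (h' : copyRel x' (y', z')) (h'' : copyRel x'' (y'', z'')) :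
    copyRel (affine4 x x' x'') (affine4 y y' y'', affine4 z z' z'') := by
  rw [copyRel_iff_coord] at *
  simp only [coord_affine4, Prod.fst_add, Prod.snd_add]
  obtain ⟨h1, h2, h3⟩ := h
  obtain ⟨h1', h2', h3'⟩ := h'
  obtain ⟨h1'', h2'', h3''⟩ := h''
  refine ⟨by rw [h1, h1', h1''], by rw [h2, h2', h2''], ?_⟩
  rw [h3, h3', h3'']
  abel

theorem deleteRel_affine : ∀ x y z : Fin 4, deleteRel x () → deleteRel y () → deleteRel z () →
    deleteRel (affine4 x y z) () := by
  decide

/-- The relations of the toy theory are affine subspaces. -/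
theorem IsSpek.affine {A B : Spek} {r : A.carrier → B.carrier → Prop} (hr : IsSpek r) :
    ∀ {x x' x'' y y' y''}, r x y → r x' y' → r x'' y'' →
      r (affine A x x' x'') (affine B y y' y'') := by
  induction hr with
  | perm σ =>
    rintro x x' x'' y y' y'' rfl rfl rfl
    exact affine_perm σ x x' x''
  | copy =>
    rintro x x' x'' ⟨y, z⟩ ⟨y', z'⟩ ⟨y'', z''⟩ h h' h''
    exact copyRel_affine _ _ _ _ _ _ _ _ _ h h' h''
  | delete =>
    intro x x' x'' y y' y'' h h' h''
    exact deleteRel_affine _ _ _ h h' h''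
  | id A => rintro x x' x'' y y' y'' rfl rfl rfl; rfl
  | assoc A B D => rintro x x' x'' y y' y'' rfl rfl rfl; rfl
  | leftUnit A => rintro x x' x'' y y' y'' rfl rfl rfl; rfl
  | rightUnit A => rintro x x' x'' y y' y'' rfl rfl rfl; rfl
  | swap A B => rintro x x' x'' y y' y'' rfl rfl rfl; rfl
  | comp _ _ ih1 ih2 =>
    rintro x x' x'' y y' y'' ⟨u, h1, h2⟩ ⟨u', h1', h2'⟩ ⟨u'', h1'', h2''⟩
    exact ⟨_, ih1 h1 h1' h1'', ih2 h2 h2' h2''⟩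
  | tensor _ _ ih1 ih2 =>
    rintro x x' x'' y y' y'' ⟨h1, h2⟩ ⟨h1', h2'⟩ ⟨h1'', h2''⟩
    exact ⟨ih1 h1 h1' h1'', ih2 h2 h2' h2''⟩
  | converse _ ih =>
    intro x x' x'' y y' y'' h h' h''
    exact ih h h' h''

/-! ## Tensor powers and wirings as relations -/

/-- The components of an element of a tensor power. -/
def get {H : Spek} : (n : ℕ) → (tpow H n).carrier → Fin n → H.carrier
  | 0, _ => fun i => i.elim0
  | n + 1, x => Fin.cons (Prod.fst (α := H.carrier) (β := (tpow H n).carrier) x)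
      (get n (Prod.snd (α := H.carrier) (β := (tpow H n).carrier) x))

theorem get_zero {H : Spek} {n : ℕ} (x : H.carrier) (y : (tpow H n).carrier) :
    get (n + 1) ((x, y) : H.carrier × (tpow H n).carrier) 0 = x := rfl

theorem get_succ {H : Spek} {n : ℕ} (x : H.carrier) (y : (tpow H n).carrier) (i : Fin n) :
    get (n + 1) ((x, y) : H.carrier × (tpow H n).carrier) i.succ = get n y i := rfl

/-- Allows a point of a tensor power to be built from an arbitrary choice of a point on each wire,
so that relations between powers can be treated wire by wire. -/
theorem get_bijective {H : Spek} : ∀ n : ℕ, Function.Bijective (get (H := H) n)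
  | 0 => ⟨fun _ _ _ => rfl, fun f => ⟨(), funext fun i => i.elim0⟩⟩
  | n + 1 => by
    refine ⟨?_, fun f => ?_⟩
    · rintro ⟨x, y⟩ ⟨x', y'⟩ h
      have h0 : x = x' := congrFun h 0
      have h1 : y = y' := (get_bijective n).1 (funext fun i => congrFun h i.succ)
      rw [h0, h1]
    · obtain ⟨y, hy⟩ := (get_bijective n).2 (fun i => f i.succ)
      refine ⟨((f 0, y) : H.carrier × (tpow H n).carrier), funext fun i => ?_⟩
      refine Fin.cases rfl (fun i => ?_) i
      rw [get_succ, hy]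

theorem get_ext {H : Spek} {n : ℕ} {x y : (tpow H n).carrier} (h : ∀ i, get n x i = get n y i) :
    x = y :=
  (get_bijective n).1 (funext h)

theorem exists_get {H : Spek} {n : ℕ} (p : (Fin n → H.carrier) → Prop) :
    (∃ x : (tpow H n).carrier, p (get n x)) ↔ ∃ f, p f :=
  ((get_bijective n).2.exists (p := p)).symm

/-- Wires can be chosen one by one. -/
theorem exists_forall_get {H : Spek} {n : ℕ} (p : Fin n → H.carrier → Prop) :
    (∃ x : (tpow H n).carrier, ∀ i, p i (get n x i)) ↔ ∀ i, ∃ a, p i a := by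
  rw [exists_get (fun f => ∀ i, p i (f i)), Classical.skolem]

theorem tensorHoms_rel {X Y : Spek} : ∀ (n : ℕ) (f : Fin n → (X ⟶ Y)) (x : (tpow X n).carrier)
    (y : (tpow Y n).carrier),
    (tensorHoms n f).rel x y ↔ ∀ i, (f i).rel (get n x i) (get n y i)
  | 0, _, _, _ => ⟨fun _ i => i.elim0, fun _ => rfl⟩
  | n + 1, f, (x, x'), (y, y') => by
    rw [Fin.forall_fin_succ]
    exact and_congr Iff.rfl (tensorHoms_rel n _ x' y')

theorem discardAll_rel {X : Spek} (d : X ⟶ 𝟙_ Spek) : ∀ (n : ℕ) (x : (tpow X n).carrier),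
    (discardAll d n).rel x () ↔ ∀ i, d.rel (get n x i) ()
  | 0, _ => ⟨fun _ i => i.elim0, fun _ => rfl⟩
  | n + 1, (x, x') => by
    rw [Fin.forall_fin_succ]
    refine Iff.trans ?_ (and_congr Iff.rfl (discardAll_rel d n x'))
    exact ⟨fun ⟨((), ()), h, _⟩ => h, fun h => ⟨((), ()), h, rfl⟩⟩

theorem keepOne_rel {X : Spek} (d : X ⟶ 𝟙_ Spek) : ∀ (n : ℕ) (i : Fin n) (x : (tpow X n).carrier)
    (y : X.carrier),
    (keepOne d n i).rel x y ↔ y = get n x i ∧ ∀ j, j ≠ i → d.rel (get n x j) ()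
  | 0, i, _, _ => i.elim0
  | n + 1, i, (x, x'), y => by
    refine Fin.cases ?_ (fun i => ?_) i
    · simp only [Fin.forall_fin_succ, ne_eq, not_true_eq_false, false_imp_iff, true_and,
        Fin.succ_ne_zero, not_false_eq_true, true_imp_iff, get_succ, get_zero]
      rw [← discardAll_rel d n x']
      constructor
      · rintro ⟨⟨a, ⟨⟩⟩, ⟨h1, h2⟩, h3⟩
        exact ⟨(show y = a from h3).trans h1, h2⟩
      · rintro ⟨rfl, h⟩
        exact ⟨(y, ()), ⟨rfl, h⟩, rfl⟩
    · simp only [Fin.forall_fin_succ, ne_eq, (Fin.succ_ne_zero i).symm, not_false_eq_true,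
        true_imp_iff, get_succ, get_zero, Fin.succ_inj]
      rw [and_left_comm, ← keepOne_rel d n i x' y]
      constructor
      · rintro ⟨⟨⟨⟩, a⟩, ⟨h1, h2⟩, b, h3, h4⟩
        obtain rfl : a = x' := h2
        obtain rfl : b = a := h3
        exact ⟨h1, h4⟩
      · rintro ⟨h1, h2⟩
        exact ⟨((), x'), ⟨h1, rfl⟩, x', rfl, h2⟩

theorem discardAll_succ_rel {X : Spek} (d : X ⟶ 𝟙_ Spek) (n : ℕ) (x : X.carrier)
    (y : (tpow X n).carrier) :
    (discardAll d (n + 1)).rel (x, y) () ↔ d.rel x () ∧ ∀ i, d.rel (get n y i) () :=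
  (discardAll_rel d (n + 1) (x, y)).trans Fin.forall_fin_succ

theorem keepOne_zero_rel {X : Spek} (d : X ⟶ 𝟙_ Spek) (n : ℕ) (x z : X.carrier)
    (y : (tpow X n).carrier) :
    (keepOne d (n + 1) 0).rel (x, y) z ↔ z = x ∧ ∀ i, d.rel (get n y i) () := by
  refine (keepOne_rel d (n + 1) 0 (x, y) z).trans (and_congr Iff.rfl ?_)
  exact ⟨fun h i => h i.succ (Fin.succ_ne_zero i),
    fun h j => Fin.cases (fun h0 => (h0 rfl).elim) (fun i _ => h i) j⟩

theorem keepOne_succ_rel {X : Spek} (d : X ⟶ 𝟙_ Spek) (n : ℕ) (s : Fin n) (x z : X.carrier)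
    (y : (tpow X n).carrier) :
    (keepOne d (n + 1) s.succ).rel (x, y) z ↔
      d.rel x () ∧ z = get n y s ∧ ∀ i, i ≠ s → d.rel (get n y i) () := by
  refine (keepOne_rel d (n + 1) s.succ (x, y) z).trans ?_
  constructor
  · rintro ⟨h1, h2⟩
    exact ⟨h2 0 (Fin.succ_ne_zero s).symm, h1,
      fun i hi => h2 i.succ fun h => hi (Fin.succ_injective _ h)⟩
  · rintro ⟨h0, h1, h2⟩
    exact ⟨h1, fun j => Fin.cases (fun _ => h0) (fun i hi => h2 i fun h => hi (h ▸ rfl)) j⟩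

theorem tensorμ_rel (A B D E : Spek) (x : (A.carrier × B.carrier) × D.carrier × E.carrier)
    (y : (A.carrier × D.carrier) × B.carrier × E.carrier) :
    (tensorμ A B D E).rel x y ↔ y = ((x.1.1, x.2.1), (x.1.2, x.2.2)) := by
  obtain ⟨⟨a, b⟩, d, e⟩ := x
  constructor
  -- The points `u`, `v`, `w`, `t` are the intermediate values in A(B(DE)), A((BD)E), A((DB)E) and
  -- A(D(BE)), between the associators and the braiding that make up `tensorμ`.
  · rintro ⟨u, hu, v, ⟨hv1, hv⟩, w, ⟨hw1, hw2, hw3⟩, t, ⟨ht1, ht⟩, hy⟩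
    replace hu : u = (a, b, d, e) := hu
    subst hu
    replace hv : (b, d, e) = (v.2.1.1, v.2.1.2, v.2.2) := hv
    replace hw2 : w.2.1 = (v.2.1.2, v.2.1.1) := hw2
    replace ht : t.2 = (w.2.1.1, w.2.1.2, w.2.2) := ht
    replace hy : t = (y.1.1, y.1.2, y.2) := hy
    replace ht1 : t.1 = w.1 := ht1
    replace hw1 : w.1 = v.1 := hw1
    replace hw3 : w.2.2 = v.2.2 := hw3
    replace hv1 : v.1 = a := hv1
    obtain ⟨⟨y1, y2⟩, y3, y4⟩ := y
    subst hy
    simp only [Prod.mk.injEq] at hv ht hw2 ht1 ⊢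
    grind
  · rintro rfl
    exact ⟨_, rfl, (a, ((b, d), e)), ⟨rfl, rfl⟩, (a, ((d, b), e)), ⟨rfl, rfl, rfl⟩,
      (a, d, b, e), ⟨rfl, rfl⟩, rfl⟩

theorem unzip_rel (X Y : Spek) : ∀ (n : ℕ) (x : (tpow (X ⊗ Y) n).carrier)
    (y : (tpow X n).carrier) (z : (tpow Y n).carrier),
    (unzip X Y n).rel x (y, z) ↔ ∀ i, get n x i = (get n y i, get n z i)
  | 0, _, _, _ => ⟨fun _ i => i.elim0, fun _ => rfl⟩
  | n + 1, ((a, b), x), (y, y'), (z, z') => by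
    rw [Fin.forall_fin_succ]
    refine Iff.trans ?_ (and_congr Iff.rfl (unzip_rel X Y n x y' z'))
    constructor
    · rintro ⟨⟨⟨_, _⟩, _, _⟩, ⟨h1, h2⟩, h3⟩
      cases h1
      cases (tensorμ_rel ..).1 h3
      exact ⟨rfl, h2⟩
    · rintro ⟨h1, h2⟩
      cases h1
      exact ⟨((y, z), y', z'), ⟨rfl, h2⟩, (tensorμ_rel ..).2 rfl⟩

theorem regroup_rel (X : Spek) (n : ℕ) : ∀ (m : ℕ) (x : (tpow (tpow X m) n).carrier)
    (y : (tpow (tpow X n) m).carrier),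
    (regroup X n m).rel x y ↔ ∀ i j, get m (get n x i) j = get n (get m y j) i
  | 0, x, () => ⟨fun _ _ j => j.elim0, fun _ => (discardAll_rel _ n x).2 fun _ => rfl⟩
  | m + 1, x, (y, y') => by
    simp only [Fin.forall_fin_succ, get_zero, get_succ]
    constructor
    · rintro ⟨⟨a, b⟩, h1, h2, h3⟩ i
      obtain rfl : y = a := h2
      have h4 := (unzip_rel X (tpow X m) n x y b).1 h1 i
      exact ⟨congrArg Prod.fst h4, fun j => (congrFun (congrArg (get m) (congrArg Prod.snd h4)) j).trans
        ((regroup_rel X n m b y').1 h3 i j)⟩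
    · intro h
      -- The intermediate point `b` collects the tails of all the groups once their first wires are
      -- split off.
      obtain ⟨b, hb⟩ := (get_bijective (H := tpow X m) n).2
        (fun i => Prod.snd (α := X.carrier) (β := (tpow X m).carrier) (get n x i))
      refine ⟨(y, b), (unzip_rel ..).2 fun i => ?_, rfl, (regroup_rel X n m b y').2 fun i j => ?_⟩
      · rw [hb]
        exact Prod.ext (h i).1 rfl
      · rw [hb]
        exact (h i).2 j

/-! ## Observables as relations -/

section Observable

variable {H : Spek} (A : DaggerQSCFA H)

theorem state_ext {φ ψ : 𝟙_ Spek ⟶ H} (h : ∀ x, φ.rel () x ↔ ψ.rel () x) : φ = ψ :=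
  hom_ext fun () y => h y

theorem comul_swap {a b c : H.carrier} (h : A.comul.rel c (a, b)) : A.comul.rel c (b, a) := by
  rw [← A.comul_comm]
  exact ⟨_, h, rfl⟩

theorem comul_counit_rel (x y : H.carrier) :
    (∃ u, A.comul.rel x (y, u) ∧ A.counit.rel u ()) ↔ x = y := by
  have h := congrArg (fun f => f.rel x (y, ())) A.comul_counit
  simp only [comp_rel, exists_tensor, whiskerLeft_rel, rightUnitor_inv_rel, eq_iff_iff] at h
  rw [← h]
  exact ⟨fun ⟨u, h1, h2⟩ => ⟨y, u, h1, rfl, h2⟩, fun ⟨y', u, h1, (h2 : y = y'), h3⟩ =>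
    ⟨u, h2 ▸ h1, h3⟩⟩

theorem eq_of_comul_counit {x y u : H.carrier} (h : A.comul.rel x (y, u)) (hu : A.counit.rel u ()) :
    x = y :=
  (comul_counit_rel A x y).1 ⟨u, h, hu⟩

theorem exists_counit (x : H.carrier) : ∃ u, A.comul.rel x (x, u) ∧ A.counit.rel u () :=
  (comul_counit_rel A x x).2 rfl

theorem comul_assoc_rel (x a b c : H.carrier) :
    (∃ u, A.comul.rel x (a, u) ∧ A.comul.rel u (b, c)) ↔
      ∃ u, A.comul.rel x (u, c) ∧ A.comul.rel u (a, b) := by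
  have h := congrArg (fun f => f.rel x (a, b, c)) A.comul_assoc
  simp only [comp_rel, exists_tensor, whiskerLeft_rel, whiskerRight_rel, associator_hom_rel,
    eq_iff_iff] at h
  constructor
  · rintro ⟨u, h1, h2⟩
    obtain ⟨v, c', h3, v1, v2, v3, ⟨h4, h5⟩, h6⟩ := h.1 ⟨a, u, h1, rfl, h2⟩
    cases h6
    obtain rfl : c = c' := h5
    exact ⟨v, h3, h4⟩
  · rintro ⟨u, h1, h2⟩
    obtain ⟨a', u', h3, h4, h5⟩ := h.2 ⟨u, c, h1, a, b, c, ⟨h2, rfl⟩, rfl⟩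
    obtain rfl : a = a' := h4
    exact ⟨u', h3, h5⟩

theorem frobenius_rel (a x y z : H.carrier) :
    (∃ u, A.comul.rel x (u, z) ∧ A.comul.rel y (a, u)) ↔
      ∃ w, A.comul.rel w (a, x) ∧ A.comul.rel w (y, z) := by
  have h := congrArg (fun f => f.rel (a, x) (y, z)) A.frobenius_left
  simp only [comp_rel, exists_tensor, whiskerLeft_rel, whiskerRight_rel, associator_inv_rel,
    dagger_rel, eq_iff_iff] at h
  rw [← h]
  constructor
  · rintro ⟨u, h1, h2⟩
    exact ⟨a, u, z, ⟨rfl, h1⟩, a, u, z, rfl, h2, rfl⟩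
  · rintro ⟨a1, u, z1, ⟨h1, h2⟩, a2, u2, z2, h3, h4, h5⟩
    cases h3
    obtain rfl : a1 = a := h1
    obtain rfl : z = z1 := h5
    exact ⟨u, h2, h4⟩

theorem one_rel (x : H.carrier) : A.one.rel () x ↔ A.counit.rel x () := Iff.rfl

theorem prodState_rel {K : Spek} (φ : 𝟙_ Spek ⟶ H) (ψ : 𝟙_ Spek ⟶ K) (x : H.carrier)
    (y : K.carrier) : (prodState φ ψ).rel () (x, y) ↔ φ.rel () x ∧ ψ.rel () y :=
  ⟨fun ⟨((), ()), _, h⟩ => h, fun h => ⟨((), ()), rfl, h⟩⟩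

theorem addState_rel (φ ψ : 𝟙_ Spek ⟶ H) (x : H.carrier) :
    (A.addState φ ψ).rel () x ↔ ∃ a b, φ.rel () a ∧ ψ.rel () b ∧ A.comul.rel x (a, b) := by
  constructor
  · rintro ⟨⟨a, b⟩, h1, h2⟩
    obtain ⟨h3, h4⟩ := (prodState_rel φ ψ a b).1 h1
    exact ⟨a, b, h3, h4, h2⟩
  · rintro ⟨a, b, h1, h2, h3⟩
    exact ⟨(a, b), (prodState_rel φ ψ a b).2 ⟨h1, h2⟩, h3⟩

theorem phaseMap_rel (φ : 𝟙_ Spek ⟶ H) (x y : H.carrier) :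
    (A.phaseMap φ).rel x y ↔ ∃ a, φ.rel () a ∧ A.comul.rel y (a, x) := by
  constructor
  · rintro ⟨⟨⟨⟩, x'⟩, h1, ⟨a, x''⟩, ⟨h2, h3⟩, h4⟩
    obtain rfl : x' = x := Eq.symm h1
    obtain rfl : x'' = x' := h3
    exact ⟨a, h2, h4⟩
  · rintro ⟨a, h1, h2⟩
    exact ⟨((), x), rfl, (a, x), ⟨h1, rfl⟩, h2⟩

theorem isPhaseState_iff (φ : 𝟙_ Spek ⟶ H) : A.IsPhaseState φ ↔
    ∀ x, (∃ a b, φ.rel () a ∧ φ.rel () b ∧ A.comul.rel a (b, x)) ↔ A.counit.rel x () := by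
  have h (x) : (φ ≫ A.comul ≫ (φ† ▷ H) ≫ (λ_ H).hom).rel () x ↔
      ∃ a b, φ.rel () a ∧ φ.rel () b ∧ A.comul.rel a (b, x) := by
    constructor
    · rintro ⟨a, h1, ⟨b, x1⟩, h2, ⟨⟨⟩, x2⟩, ⟨h3, h4⟩, h5⟩
      obtain rfl : x = x2 := h5
      obtain rfl : x = x1 := h4
      exact ⟨a, b, h1, h3, h2⟩
    · rintro ⟨a, b, h1, h2, h3⟩
      exact ⟨a, h1, (b, x), h3, ((), x), ⟨h2, rfl⟩, rfl⟩
  refine ⟨fun hφ x => ?_, fun hφ => state_ext fun x => (h x).trans (hφ x)⟩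
  rw [← h, show φ ≫ A.comul ≫ (φ† ▷ H) ≫ (λ_ H).hom = A.one from hφ]
  rfl

theorem isClassical_iff (φ : 𝟙_ Spek ⟶ H) : A.IsClassical φ ↔
    ∀ x y, (∃ a, φ.rel () a ∧ A.comul.rel a (x, y)) ↔ φ.rel () x ∧ φ.rel () y := by
  refine ⟨fun h x y => ?_, fun h => state_ext fun ⟨x, y⟩ => ?_⟩
  · rw [← prodState_rel, ← show φ ≫ A.comul = _ from h]
    rfl
  · rw [prodState_rel]
    exact h x y

/-! ## Addition of states -/

theorem addState_comm (φ ψ : 𝟙_ Spek ⟶ H) : A.addState φ ψ = A.addState ψ φ := by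
  refine state_ext fun x => ?_
  simp only [addState_rel]
  exact ⟨fun ⟨a, b, h1, h2, h3⟩ => ⟨b, a, h2, h1, comul_swap A h3⟩,
    fun ⟨a, b, h1, h2, h3⟩ => ⟨b, a, h2, h1, comul_swap A h3⟩⟩

theorem addState_assoc (φ ψ χ : 𝟙_ Spek ⟶ H) :
    A.addState (A.addState φ ψ) χ = A.addState φ (A.addState ψ χ) := by
  refine state_ext fun x => ?_
  simp only [addState_rel]
  constructor
  · rintro ⟨u, c, ⟨a, b, h1, h2, h3⟩, h4, h5⟩
    obtain ⟨v, h6, h7⟩ := (comul_assoc_rel A x a b c).2 ⟨u, h5, h3⟩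
    exact ⟨a, v, h1, ⟨b, c, h2, h4, h7⟩, h6⟩
  · rintro ⟨a, u, h1, ⟨b, c, h2, h3, h4⟩, h5⟩
    obtain ⟨v, h6, h7⟩ := (comul_assoc_rel A x a b c).1 ⟨u, h5, h4⟩
    exact ⟨v, c, ⟨a, b, h1, h2, h7⟩, h3, h6⟩

theorem addState_one (φ : 𝟙_ Spek ⟶ H) : A.addState φ A.one = φ := by
  refine state_ext fun x => ?_
  simp only [addState_rel, one_rel]
  constructor
  · rintro ⟨a, b, h1, h2, h3⟩
    rwa [eq_of_comul_counit A h3 h2]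
  · intro h
    obtain ⟨u, h1, h2⟩ := exists_counit A x
    exact ⟨x, u, h, h2, h1⟩

/-- The states of order two under addition. -/
def TwoTorsion : Type := {φ : 𝟙_ Spek ⟶ H // A.addState φ φ = A.one}

instance : Zero (TwoTorsion A) := ⟨⟨A.one, addState_one A _⟩⟩

instance : Add (TwoTorsion A) where
  add φ ψ := ⟨A.addState φ.1 ψ.1, by
    rw [addState_assoc, addState_comm A φ.1 ψ.1, ← addState_assoc A ψ.1, ψ.2, addState_comm A A.one,
      addState_one, φ.2]⟩

instance : Neg (TwoTorsion A) := ⟨id⟩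

/-- Taking all states of order two, and not only the phase states, makes closure under addition and
the existence of inverses immediate; each element is its own inverse. -/
instance : AddCommGroup (TwoTorsion A) where
  add_assoc φ ψ χ := Subtype.ext (addState_assoc A _ _ _)
  zero_add φ := Subtype.ext ((addState_comm A _ _).trans (addState_one A _))
  add_zero φ := Subtype.ext (addState_one A _)
  add_comm φ ψ := Subtype.ext (addState_comm A _ _)
  neg_add_cancel φ := Subtype.ext φ.2
  nsmul := nsmulRec
  zsmul := zsmulRec

theorem TwoTorsion.val_add (φ ψ : TwoTorsion A) : (φ + ψ).1 = A.addState φ.1 ψ.1 := rfl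

theorem TwoTorsion.add_self (φ : TwoTorsion A) : φ + φ = 0 := Subtype.ext φ.2

theorem TwoTorsion.val_sum : ∀ (n : ℕ) (φ : Fin n → TwoTorsion A),
    (∑ i, φ i).1 = A.sumState n (fun i => (φ i).1)
  | 0, _ => rfl
  | n + 1, φ => by
    rw [Fin.sum_univ_succ, TwoTorsion.val_add, TwoTorsion.val_sum n]
    rfl

/-! ### Phase states have order two -/

/-- The point `u` acts as a local unit for `a`. The counit law makes it idempotent, and adding the
related triples (a; a, u), (u; u, u), (a; u, a) in the affine sense gives (u; a, a), so `a` is its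
own inverse. -/
theorem unit_comul_rel {u : H.carrier} {a : H.carrier} (hu : A.counit.rel u ())
    (h : A.comul.rel a (a, u)) : A.comul.rel u (u, u) ∧ A.comul.rel u (a, a) := by
  obtain ⟨v, h1, h2⟩ := exists_counit A u
  obtain rfl : u = v := eq_of_comul_counit A (comul_swap A h1) hu
  refine ⟨h1, ?_⟩
  have := A.comul.isSpek.affine h h1 (comul_swap A h)
  change A.comul.rel _ (affine H a u u, affine H u u a) at this
  rwa [affine_self_outer, affine_self_left, affine_self_right] at this

/-- With `u` the local unit of `a`, adding (a; a, u) and (u; u, u) to (b; a, x) gives (b + a + u; u,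
x), so the counit law forces x = b + a + u. Adding (a; a, u) and (u; a, a) instead gives (x; a, x +
u + a), and x + u + a = b. -/
theorem comul_rotate {a b x : H.carrier} (h : A.comul.rel b (a, x)) : A.comul.rel x (a, b) := by
  obtain ⟨u, h1, hu⟩ := exists_counit A a
  obtain ⟨h2, h3⟩ := unit_comul_rel A hu h1
  have h4 := A.comul.isSpek.affine h h1 h2
  change A.comul.rel _ (affine H a a u, affine H x u u) at h4
  rw [affine_self_left, affine_self_right] at h4
  have h5 := eq_of_comul_counit A (comul_swap A h4) hu
  have h6 := A.comul.isSpek.affine h h1 h3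
  change A.comul.rel _ (affine H a a a, affine H x u a) at h6
  rwa [affine_self_left, ← h5, affine_affine_swap, h5] at h6

/-- The phase states of every observable of the toy theory have order two. -/
theorem addState_self_of_isPhaseState {φ : 𝟙_ Spek ⟶ H} (h : A.IsPhaseState φ) :
    A.addState φ φ = A.one := by
  refine state_ext fun x => ?_
  -- The phase condition describes the unit by triples with input in `φ` and one output in `φ`;
  -- rotation turns these into the triples that define the sum of `φ` with itself.
  rw [addState_rel, one_rel, ← (isPhaseState_iff A φ).1 h]
  constructor
  · rintro ⟨a, b, h1, h2, h3⟩
    exact ⟨b, a, h2, h1, comul_rotate A h3⟩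
  · rintro ⟨b, a, h1, h2, h3⟩
    exact ⟨a, b, h2, h1, comul_rotate A h3⟩

end Observable
/-! ## Phases and spiders -/

section Spider

variable {H : Spek} (A : DaggerQSCFA H)

theorem phaseMap_one : A.phaseMap A.one = 𝟙 H := by
  refine hom_ext fun x y => ?_
  rw [phaseMap_rel, id_rel]
  constructor
  · rintro ⟨a, h1, h2⟩
    exact eq_of_comul_counit A (comul_swap A h2) h1
  · rintro rfl
    obtain ⟨u, h1, h2⟩ := exists_counit A y
    exact ⟨u, h2, comul_swap A h1⟩

theorem comp_phaseMap (φ ψ : 𝟙_ Spek ⟶ H) : ψ ≫ A.phaseMap φ = A.addState φ ψ := by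
  refine state_ext fun x => ?_
  rw [addState_rel, comp_rel]
  simp only [phaseMap_rel]
  exact ⟨fun ⟨b, h1, a, h2, h3⟩ => ⟨a, b, h2, h1, h3⟩, fun ⟨a, b, h2, h1, h3⟩ => ⟨b, h1, a, h2, h3⟩⟩

theorem phaseMap_addState (φ ψ : 𝟙_ Spek ⟶ H) :
    A.phaseMap (A.addState φ ψ) = A.phaseMap φ ≫ A.phaseMap ψ := by
  refine hom_ext fun x y => ?_
  -- In the composite `φ` acts first and is the inner factor, so the summands are exchanged before
  -- associativity applies.
  rw [addState_comm]
  simp only [comp_rel, phaseMap_rel, addState_rel]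
  constructor
  · rintro ⟨c, ⟨a, b, h1, h2, h3⟩, h4⟩
    obtain ⟨u, h5, h6⟩ := (comul_assoc_rel A y a b x).2 ⟨c, h4, h3⟩
    exact ⟨u, ⟨b, h2, h6⟩, a, h1, h5⟩
  · rintro ⟨u, ⟨b, h2, h6⟩, a, h1, h5⟩
    obtain ⟨c, h4, h3⟩ := (comul_assoc_rel A y a b x).1 ⟨u, h5, h6⟩
    exact ⟨c, ⟨a, b, h1, h2, h3⟩, h4⟩

/-- A phase may enter a comultiplication on either output. -/
theorem comul_phaseMap_left (φ : 𝟙_ Spek ⟶ H) :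
    A.comul ≫ (A.phaseMap φ ▷ H) = A.phaseMap φ ≫ A.comul := by
  refine hom_ext fun x ⟨y, z⟩ => ?_
  constructor
  · rintro ⟨⟨u, z'⟩, h1, h2, h3⟩
    obtain rfl : z = z' := h3
    obtain ⟨a, h4, h5⟩ := (phaseMap_rel A φ u y).1 h2
    obtain ⟨w, h6, h7⟩ := (frobenius_rel A a x y z).1 ⟨u, h1, h5⟩
    exact ⟨w, (phaseMap_rel A φ x w).2 ⟨a, h4, h6⟩, h7⟩
  · rintro ⟨w, h1, h2⟩
    obtain ⟨a, h4, h6⟩ := (phaseMap_rel A φ x w).1 h1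
    obtain ⟨u, h7, h5⟩ := (frobenius_rel A a x y z).2 ⟨w, h6, h2⟩
    exact ⟨(u, z), h7, (phaseMap_rel A φ u y).2 ⟨a, h4, h5⟩, rfl⟩

theorem comul_phaseMap_right (φ : 𝟙_ Spek ⟶ H) :
    A.comul ≫ (H ◁ A.phaseMap φ) = A.phaseMap φ ≫ A.comul := by
  have h := congrArg (· ≫ (β_ H H).hom) (comul_phaseMap_left A φ)
  simpa [A.comul_comm, reassoc_of% A.comul_comm] using h

/-- The phases on the outputs of a spider add up. -/
theorem copyTo_comp_phaseMap : ∀ (n : ℕ) (φ : Fin n → (𝟙_ Spek ⟶ H)),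
    A.copyTo n ≫ tensorHoms n (fun i => A.phaseMap (φ i)) =
      A.phaseMap (A.sumState n φ) ≫ A.copyTo n
  | 0, φ => by
    change A.counit ≫ 𝟙 _ = A.phaseMap A.one ≫ A.counit
    rw [phaseMap_one, Category.comp_id, Category.id_comp]
  | n + 1, φ => by
    change (A.comul ≫ (H ◁ A.copyTo n)) ≫ (A.phaseMap (φ 0) ⊗ₘ
      tensorHoms n (fun i => A.phaseMap (φ i.succ))) =
      A.phaseMap (A.addState (φ 0) (A.sumState n fun i => φ i.succ)) ≫ A.comul ≫ (H ◁ A.copyTo n)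
    rw [phaseMap_addState, MonoidalCategory.tensorHom_def', Category.assoc, ← whiskerLeft_comp_assoc,
      copyTo_comp_phaseMap n, whiskerLeft_comp_assoc, reassoc_of% comul_phaseMap_right,
      whisker_exchange, reassoc_of% comul_phaseMap_left, Category.assoc]
    simp only [← Category.assoc]
    rw [← phaseMap_addState, addState_comm, phaseMap_addState]

/-- Phases slide through the spider and accumulate, so only their sum matters. This is what permits
changing the individual phases of a measurement. -/
theorem phasedGHZ_eq {N : ℕ} (φ : Fin N → (𝟙_ Spek ⟶ H)) :
    phasedGHZ A φ = A.sumState N φ ≫ A.copyTo N := by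
  rw [phasedGHZ, ghz, Category.assoc, copyTo_comp_phaseMap, ← Category.assoc, comp_phaseMap,
    addState_one]

/-- The phase of a state of order two is unitary. -/
theorem phaseMap_comp_dagger {φ : 𝟙_ Spek ⟶ H} (h : A.addState φ φ = A.one) :
    A.phaseMap φ ≫ (A.phaseMap φ)† = 𝟙 H := by
  have hid : A.phaseMap φ ≫ A.phaseMap φ = 𝟙 H := by rw [← phaseMap_addState, h, phaseMap_one]
  have hrel (x y : H.carrier) :
      (∃ u, (A.phaseMap φ).rel x u ∧ (A.phaseMap φ).rel u y) ↔ y = x := by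
    rw [← comp_rel, hid, id_rel]
  have hsymm (x y : H.carrier) (hxy : (A.phaseMap φ).rel x y) : (A.phaseMap φ).rel y x := by
    -- A relation whose square is the identity is symmetric: a point `u` reached from `y` is also
    -- reached from `x` in two steps, so it is `x`.
    obtain ⟨u, h1, h2⟩ := (hrel y y).2 rfl
    rwa [← (hrel x u).1 ⟨y, hxy, h1⟩]
  refine hom_ext fun x y => ?_
  rw [id_rel, ← hrel x y]
  exact exists_congr fun u => and_congr_right fun _ => ⟨hsymm _ _, hsymm _ _⟩

/-! ### Discarding the legs of spiders and wirings -/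

theorem copyTo_succ_rel (n : ℕ) (x a : H.carrier) (y : (tpow H n).carrier) :
    (A.copyTo (n + 1)).rel x (a, y) ↔ ∃ u, A.comul.rel x (a, u) ∧ (A.copyTo n).rel u y := by
  constructor
  · rintro ⟨⟨a', u⟩, h1, h2, h3⟩
    obtain rfl : a = a' := h2
    exact ⟨u, h1, h3⟩
  · rintro ⟨u, h1, h2⟩
    exact ⟨(a, u), h1, rfl, h2⟩

theorem copyTo_discardAll : ∀ n : ℕ, A.copyTo n ≫ discardAll A.counit n = A.counit
  | 0 => Category.comp_id _
  | n + 1 => by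
    refine hom_ext fun x ⟨⟩ => ?_
    have ih (u) : (∃ y, (A.copyTo n).rel u y ∧ (discardAll A.counit n).rel y ()) ↔
      A.counit.rel u () := by rw [← comp_rel, copyTo_discardAll n]
    constructor
    · rintro ⟨⟨a, y⟩, h1, h2⟩
      obtain ⟨u, h3, h4⟩ := (copyTo_succ_rel A n x a y).1 h1
      replace h2 := (discardAll_succ_rel ..).1 h2
      have hu := (ih u).1 ⟨y, h4, (discardAll_rel _ _ _).2 h2.2⟩
      rw [eq_of_comul_counit A h3 hu]
      exact h2.1
    · intro h
      obtain ⟨u, h1, h2⟩ := exists_counit A x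
      obtain ⟨y, h3, h4⟩ := (ih u).2 h2
      refine ⟨(x, y), (copyTo_succ_rel A n x x y).2 ⟨u, h1, h3⟩,
        (discardAll_succ_rel ..).2 ⟨h, (discardAll_rel _ _ _).1 h4⟩⟩

theorem copyTo_keepOne : ∀ (n : ℕ) (r : Fin n), A.copyTo n ≫ keepOne A.counit n r = 𝟙 H
  | 0, r => r.elim0
  | n + 1, r => by
    refine Fin.cases ?_ (fun r => ?_) r
    · change (A.comul ≫ (H ◁ A.copyTo n)) ≫ (H ◁ discardAll A.counit n) ≫ (ρ_ H).hom = _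
      rw [Category.assoc, ← whiskerLeft_comp_assoc, copyTo_discardAll, ← Category.assoc,
        A.comul_counit, Iso.inv_hom_id]
    · change (A.comul ≫ (H ◁ A.copyTo n)) ≫ (A.counit ▷ tpow H n) ≫ (λ_ (tpow H n)).hom ≫
        keepOne A.counit n r = _
      rw [Category.assoc, whisker_exchange_assoc, ← Category.assoc, A.counit_comul,
        leftUnitor_naturality_assoc, Iso.inv_hom_id_assoc, copyTo_keepOne n r]

theorem copyAll_rel (n : ℕ) (x y z : (tpow H n).carrier) :
    (A.copyAll n).rel x (y, z) ↔ ∀ i, A.comul.rel (get n x i) (get n y i, get n z i) := by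
  constructor
  · rintro ⟨w, h1, h2⟩ i
    rw [← (unzip_rel H H n w y z).1 h2 i]
    exact (tensorHoms_rel n _ x w).1 h1 i
  · intro h
    obtain ⟨w, hw⟩ := (get_bijective (H := H ⊗ H) n).2 fun i => (get n y i, get n z i)
    have hw' := congrFun hw
    refine ⟨w, (tensorHoms_rel n _ x w).2 fun i => ?_, (unzip_rel H H n w y z).2 hw'⟩
    rw [hw' i]
    exact h i

theorem tensorHoms_comp {X Y W : Spek} (n : ℕ) (f : Fin n → (X ⟶ Y)) (g : Fin n → (Y ⟶ W)) :
    tensorHoms n f ≫ tensorHoms n g = tensorHoms n (fun i => f i ≫ g i) := by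
  refine hom_ext fun x z => ?_
  simp only [comp_rel, tensorHoms_rel, ← forall_and]
  exact exists_forall_get fun i a => (f i).rel (get n x i) a ∧ (g i).rel a (get n z i)

theorem tensorHoms_id {X : Spek} (n : ℕ) : tensorHoms n (fun _ => 𝟙 X) = 𝟙 (tpow X n) := by
  refine hom_ext fun x y => ?_
  simp only [tensorHoms_rel, id_rel]
  exact ⟨get_ext, fun h i => h ▸ rfl⟩

theorem dagger_tensorHoms {X Y : Spek} (n : ℕ) (f : Fin n → (X ⟶ Y)) :
    (tensorHoms n f)† = tensorHoms n (fun i => (f i)†) := by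
  refine hom_ext fun y x => ?_
  rw [dagger_rel, tensorHoms_rel, tensorHoms_rel]
  rfl

/-- On the discarded wires the maps are absorbed by `d`; only the map on the surviving wire remains.
-/
theorem tensorHoms_keepOne {X : Spek} (d : X ⟶ 𝟙_ Spek) (n : ℕ) (f : Fin n → (X ⟶ X))
    (hf : ∀ i, f i ≫ d = d) (r : Fin n) :
    tensorHoms n f ≫ keepOne d n r = keepOne d n r ≫ f r := by
  refine hom_ext fun x z => ?_
  have hd (i) (a) : (∃ b, (f i).rel a b ∧ d.rel b ()) ↔ d.rel a () := by rw [← comp_rel, hf]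
  simp only [comp_rel, tensorHoms_rel, keepOne_rel]
  constructor
  · rintro ⟨y, h1, rfl, h2⟩
    exact ⟨_, ⟨rfl, fun j hj => (hd j _).1 ⟨_, h1 j, h2 j hj⟩⟩, h1 r⟩
  · rintro ⟨y, ⟨rfl, h1⟩, h2⟩
    -- The intermediate point is `z` on the kept wire and, on each other wire, a preimage supplied
    -- by absorption into `d`.
    obtain ⟨y, hy⟩ := (exists_forall_get (H := X) fun j a => (f j).rel (get n x j) a ∧
      (j = r → z = a) ∧ (j ≠ r → d.rel a ())).2 fun j => by
        by_cases hj : j = r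
        · subst hj; exact ⟨z, h2, fun _ => rfl, fun h => (h rfl).elim⟩
        · obtain ⟨b, h3, h4⟩ := (hd j _).2 (h1 j hj)
          exact ⟨b, h3, fun h => (hj h).elim, fun _ => h4⟩
    exact ⟨y, fun i => (hy i).1, (hy r).2.1 rfl, fun j => (hy j).2.2⟩

theorem wire_succ_rel (m n : ℕ) (f : Fin (n + 1) → Fin m) (x : (tpow H m).carrier) (a : H.carrier)
    (y : (tpow H n).carrier) :
    (A.wire m (n + 1) f).rel x (a, y) ↔ ∃ p q : (tpow H m).carrier,
      (∀ r, A.comul.rel (get m x r) (get m p r, get m q r)) ∧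
      (a = get m p (f 0) ∧ ∀ r, r ≠ f 0 → A.counit.rel (get m p r) ()) ∧
      (A.wire m n (fun s => f s.succ)).rel q y := by
  simp only [← copyAll_rel, ← keepOne_rel]
  exact ⟨fun ⟨⟨p, q⟩, h1, h2⟩ => ⟨p, q, h1, h2⟩, fun ⟨p, q, h1, h2⟩ => ⟨(p, q), h1, h2⟩⟩

theorem exists_counit_get (m : ℕ) (x : (tpow H m).carrier) : ∃ q : (tpow H m).carrier,
    ∀ r, A.comul.rel (get m x r) (get m x r, get m q r) ∧ A.counit.rel (get m q r) () :=
  (exists_forall_get fun r a => A.comul.rel (get m x r) (get m x r, a) ∧ A.counit.rel a ()).2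
    fun _ => exists_counit A _

theorem wire_discardAll (m : ℕ) : ∀ (n : ℕ) (f : Fin n → Fin m),
    A.wire m n f ≫ discardAll A.counit n = discardAll A.counit m
  | 0, _ => Category.comp_id _
  | n + 1, f => by
    refine hom_ext fun x ⟨⟩ => ?_
    have ih (q) : (∃ y, (A.wire m n fun s => f s.succ).rel q y ∧
        (discardAll A.counit n).rel y ()) ↔ ∀ r, A.counit.rel (get m q r) () := by
      rw [← comp_rel, wire_discardAll m n, discardAll_rel]
    rw [discardAll_rel]
    constructor
    · rintro ⟨⟨a, y⟩, h1, h2⟩ r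
      obtain ⟨p, q, h3, ⟨rfl, h4⟩, h5⟩ := (wire_succ_rel A m n f x a y).1 h1
      replace h2 := (discardAll_succ_rel ..).1 h2
      have hq := (ih q).1 ⟨y, h5, (discardAll_rel _ _ _).2 h2.2⟩
      rw [eq_of_comul_counit A (h3 r) (hq r)]
      by_cases hr : r = f 0
      · rw [hr]; exact h2.1
      · exact h4 r hr
    · intro h
      obtain ⟨q, hq⟩ := exists_counit_get A m x
      obtain ⟨y, h1, h2⟩ := (ih q).2 fun r => (hq r).2
      refine ⟨(get m x (f 0), y), (wire_succ_rel A m n f x _ y).2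
        ⟨x, q, fun r => (hq r).1, ⟨rfl, fun r _ => h r⟩, h1⟩,
        (discardAll_succ_rel ..).2 ⟨h _, (discardAll_rel _ _ _).1 h2⟩⟩

/-- Capping a leg of a spider with the counit removes it. When only the leg `s` is left, its spider
becomes a plain wire and every other input is discarded. -/
theorem wire_keepOne (m : ℕ) : ∀ (n : ℕ) (f : Fin n → Fin m) (s : Fin n),
    A.wire m n f ≫ keepOne A.counit n s = keepOne A.counit m (f s)
  | 0, _, s => s.elim0
  | n + 1, f, s => by
    refine hom_ext fun x z => ?_
    rw [keepOne_rel]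
    refine Fin.cases ?_ (fun s => ?_) s
    -- If the first leg is kept, the remaining legs force `q` into the counit everywhere, so `p`
    -- equals `x`.
    · have ih (q) : (∃ y, (A.wire m n fun s => f s.succ).rel q y ∧
          (discardAll A.counit n).rel y ()) ↔ ∀ r, A.counit.rel (get m q r) () := by
        rw [← comp_rel, wire_discardAll, discardAll_rel]
      constructor
      · rintro ⟨⟨a, y⟩, h1, h2⟩
        obtain ⟨p, q, h3, ⟨rfl, h4⟩, h5⟩ := (wire_succ_rel A m n f x a y).1 h1
        obtain ⟨h6, h7⟩ := (keepOne_zero_rel ..).1 h2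
        have hq := (ih q).1 ⟨y, h5, (discardAll_rel _ _ _).2 h7⟩
        have hp (r) := eq_of_comul_counit A (h3 r) (hq r)
        refine ⟨h6.trans (hp (f 0)).symm, fun r hr => ?_⟩
        rw [hp r]
        exact h4 r hr
      · rintro ⟨rfl, h⟩
        obtain ⟨q, hq⟩ := exists_counit_get A m x
        obtain ⟨y, h1, h2⟩ := (ih q).2 fun r => (hq r).2
        refine ⟨(get m x (f 0), y), (wire_succ_rel A m n f x _ y).2
          ⟨x, q, fun r => (hq r).1, ⟨rfl, h⟩, h1⟩,
          (keepOne_zero_rel ..).2 ⟨rfl, (discardAll_rel _ _ _).1 h2⟩⟩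
    -- If a later leg is kept, all of `p` lies in the counit, so `q` equals `x` and induction
    -- applies.
    · have ih (q) : (∃ y, (A.wire m n fun s => f s.succ).rel q y ∧
          (keepOne A.counit n s).rel y z) ↔
          z = get m q (f s.succ) ∧ ∀ r, r ≠ f s.succ → A.counit.rel (get m q r) () := by
        rw [← comp_rel, wire_keepOne m n, keepOne_rel]
      constructor
      · rintro ⟨⟨a, y⟩, h1, h2⟩
        obtain ⟨p, q, h3, ⟨rfl, h4⟩, h5⟩ := (wire_succ_rel A m n f x a y).1 h1
        obtain ⟨h6, h7⟩ := (keepOne_succ_rel ..).1 h2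
        obtain rfl : x = q := get_ext fun r => by
          refine eq_of_comul_counit A (comul_swap A (h3 r)) ?_
          by_cases hr : r = f 0
          · rw [hr]; exact h6
          · exact h4 r hr
        exact (ih x).1 ⟨y, h5, (keepOne_rel _ _ _ _ _).2 h7⟩
      · intro h
        obtain ⟨y, h1, h2⟩ := (ih x).2 h
        obtain ⟨p, hp⟩ := exists_counit_get A m x
        refine ⟨(get m p (f 0), y), (wire_succ_rel A m n f x _ y).2
          ⟨p, x, fun r => comul_swap A (hp r).1, ⟨rfl, fun r _ => (hp r).2⟩, h1⟩,
          (keepOne_succ_rel ..).2 ⟨(hp _).2, (keepOne_rel _ _ _ _ _).1 h2⟩⟩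

/-- Keeping one group of wires after a regrouping. -/
theorem tensorHoms_regroup_keepOne {X Y : Spek} (d : Y ⟶ 𝟙_ Spek) (n m : ℕ)
    (f : Fin n → (X ⟶ tpow Y m)) (s : Fin m) :
    tensorHoms n f ≫ regroup Y n m ≫ keepOne (discardAll d n) m s =
      tensorHoms n (fun i => f i ≫ keepOne d m s) := by
  refine hom_ext fun x z => ?_
  simp only [comp_rel, tensorHoms_rel, regroup_rel, keepOne_rel, discardAll_rel]
  constructor
  · rintro ⟨y, h1, w, h2, rfl, h3⟩ i
    refine ⟨get n y i, h1 i, (h2 i s).symm, fun j hj => ?_⟩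
    rw [h2]
    exact h3 j hj i
  · intro h
    obtain ⟨y, hy⟩ := (exists_forall_get (H := tpow Y m) fun i a => (f i).rel (get n x i) a ∧
      get n z i = get m a s ∧ ∀ j, j ≠ s → d.rel (get m a j) ()).2 h
    obtain ⟨w, hw⟩ := (exists_forall_get (H := tpow Y n) fun j b =>
      ∀ i, get m (get n y i) j = get n b i).2 fun j =>
        (exists_forall_get (H := Y) fun i c => get m (get n y i) j = c).2 fun i => ⟨_, rfl⟩
    refine ⟨y, fun i => (hy i).1, w, fun i j => hw j i, get_ext fun i => ?_, fun j hj i => ?_⟩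
    · rw [← hw s i]
      exact (hy i).2.1
    · rw [← hw j i]
      exact (hy i).2.2 j hj

end Spider

/-! ## Strongly complementary pairs -/

section Complementary

variable {H : Spek} {Z X : DaggerQSCFA H}

theorem bialgebra_rel (hZX : StronglyComplementary Z X) (p q a b : H.carrier) :
    (∃ c, X.comul.rel c (p, q) ∧ Z.comul.rel c (a, b)) ↔ ∃ a1 b1 a2 b2,
      Z.comul.rel p (a1, b1) ∧ Z.comul.rel q (a2, b2) ∧
        X.comul.rel a (a1, a2) ∧ X.comul.rel b (b1, b2) := by
  have h := congrArg (fun f => f.rel (p, q) (a, b)) hZX.bialgebra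
  simp only [comp_rel, eq_iff_iff] at h
  refine h.trans ?_
  constructor
  · rintro ⟨⟨⟨a1, b1⟩, a2, b2⟩, ⟨h1, h2⟩, w, h3, h4, h5⟩
    cases (tensorμ_rel ..).1 h3
    exact ⟨a1, b1, a2, b2, h1, h2, h4, h5⟩
  · rintro ⟨a1, b1, a2, b2, h1, h2, h4, h5⟩
    exact ⟨((a1, b1), a2, b2), ⟨h1, h2⟩, ((a1, a2), b1, b2), (tensorμ_rel ..).2 rfl, h4, h5⟩

theorem unit_copy_rel (hZX : StronglyComplementary Z X) (a b : H.carrier) :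
    (∃ c, X.counit.rel c () ∧ Z.comul.rel c (a, b)) ↔ X.counit.rel a () ∧ X.counit.rel b () := by
  have h := congrArg (fun f => f.rel () (a, b)) hZX.unit_copy
  rw [prodState_rel] at h
  exact iff_of_eq h

theorem counit_copy_rel (hZX : StronglyComplementary Z X) (a b : H.carrier) :
    (∃ c, X.comul.rel c (a, b) ∧ Z.counit.rel c ()) ↔ Z.counit.rel a () ∧ Z.counit.rel b () := by
  have h := congrArg (fun f => f.rel (a, b) ()) hZX.counit_copy
  exact (iff_of_eq h).trans ⟨fun ⟨((), ()), h, _⟩ => h, fun h => ⟨((), ()), h, rfl⟩⟩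

theorem isClassical_one (hZX : StronglyComplementary Z X) : X.IsClassical Z.one := by
  rw [isClassical_iff]
  intro x y
  rw [one_rel, one_rel, ← counit_copy_rel hZX]
  exact exists_congr fun c => and_comm

/-- The phase of a classical state commutes with the classical comultiplication. -/
theorem phaseMap_comul_of_isClassical (hZX : StronglyComplementary Z X)
    {φ : 𝟙_ Spek ⟶ H} (hφ : X.IsClassical φ) (x p q : H.carrier) :
    (∃ c, (Z.phaseMap φ).rel x c ∧ X.comul.rel c (p, q)) ↔
      ∃ b1 b2, X.comul.rel x (b1, b2) ∧ (Z.phaseMap φ).rel b1 p ∧ (Z.phaseMap φ).rel b2 q := by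
  rw [isClassical_iff] at hφ
  simp only [phaseMap_rel]
  constructor
  · rintro ⟨c, ⟨a, h1, h2⟩, h3⟩
    obtain ⟨a1, b1, a2, b2, h4, h5, h6, h7⟩ := (bialgebra_rel hZX p q a x).1 ⟨c, h3, h2⟩
    obtain ⟨h8, h9⟩ := (hφ a1 a2).1 ⟨a, h1, h6⟩
    exact ⟨b1, b2, h7, ⟨a1, h8, h4⟩, a2, h9, h5⟩
  · rintro ⟨b1, b2, h7, ⟨a1, h8, h4⟩, a2, h9, h5⟩
    obtain ⟨a, h1, h6⟩ := (hφ a1 a2).2 ⟨h8, h9⟩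
    obtain ⟨c, h3, h2⟩ := (bialgebra_rel hZX p q a x).2 ⟨a1, b1, a2, b2, h4, h5, h6, h7⟩
    exact ⟨c, ⟨a, h1, h2⟩, h3⟩

/-- Adding `φ` to `ψ` applies the phase of `φ`. By the bialgebra law, copying afterwards amounts to
copying `ψ` and applying the phase to both copies. -/
theorem isClassical_addState (hZX : StronglyComplementary Z X)
    {φ ψ : 𝟙_ Spek ⟶ H} (hφ : X.IsClassical φ) (hψ : X.IsClassical ψ) :
    X.IsClassical (Z.addState φ ψ) := by
  have h := phaseMap_comul_of_isClassical hZX hφ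
  rw [isClassical_iff] at hψ ⊢
  intro p q
  simp only [← comp_phaseMap, comp_rel]
  constructor
  · rintro ⟨c, ⟨x, h1, h2⟩, h3⟩
    obtain ⟨b1, b2, h4, h5, h6⟩ := (h x p q).1 ⟨c, h2, h3⟩
    obtain ⟨h7, h8⟩ := (hψ b1 b2).1 ⟨x, h1, h4⟩
    exact ⟨⟨b1, h7, h5⟩, b2, h8, h6⟩
  · rintro ⟨⟨b1, h7, h5⟩, b2, h8, h6⟩
    obtain ⟨x, h1, h4⟩ := (hψ b1 b2).2 ⟨h7, h8⟩
    obtain ⟨c, h2, h3⟩ := (h x p q).2 ⟨b1, b2, h4, h5, h6⟩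
    exact ⟨c, ⟨x, h1, h2⟩, h3⟩

/-- By the coherence law for the unit of `X`, a `Z`-product can lie in the counit of `X` exactly
when both factors do. It remains to see that `φ` meets that counit. -/
theorem phaseMap_counit_of_isClassical (hZX : StronglyComplementary Z X)
    {φ : 𝟙_ Spek ⟶ H} (hφ : X.IsClassical φ)
    (h2 : Z.addState φ φ = Z.one) : Z.phaseMap φ ≫ X.counit = X.counit := by
  -- The sum of `φ` with itself is the nonempty unit, so `φ` has a point `a`; copying `a` as itself
  -- and a counit point `v` puts `v` in `φ` by classicality.
  have hne : ∃ a, φ.rel () a ∧ X.counit.rel a () := by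
    obtain ⟨u, -, hu⟩ := exists_counit Z (Classical.choice (nonempty_carrier H))
    rw [← one_rel, ← h2, addState_rel] at hu
    obtain ⟨a, -, ha, -⟩ := hu
    obtain ⟨v, h3, h4⟩ := exists_counit X a
    exact ⟨v, ((isClassical_iff X φ).1 hφ a v |>.1 ⟨a, ha, h3⟩).2, h4⟩
  refine hom_ext fun x ⟨⟩ => ?_
  simp only [comp_rel, phaseMap_rel]
  constructor
  · rintro ⟨y, ⟨a, h3, h4⟩, h5⟩
    exact ((unit_copy_rel hZX a x).1 ⟨y, h5, h4⟩).2
  · intro hx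
    obtain ⟨a, h3, h4⟩ := hne
    obtain ⟨y, h5, h6⟩ := (unit_copy_rel hZX a x).2 ⟨h4, hx⟩
    exact ⟨y, ⟨a, h3, h6⟩, h5⟩

/-- The classical states of order two. -/
def classicalTwoTorsion (hZX : StronglyComplementary Z X) : AddSubgroup (TwoTorsion Z) where
  carrier := {φ | X.IsClassical φ.1}
  add_mem' h h' := isClassical_addState hZX h h'
  zero_mem' := isClassical_one hZX
  neg_mem' h := h

/-- Classical phases commute with the measurement. -/
theorem measureIn_phasedGHZ (hZX : StronglyComplementary Z X) {N : ℕ} (φ : Fin N → (𝟙_ Spek ⟶ H))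
    (hφ : ∀ i, X.IsClassical (φ i)) (h2 : ∀ i, Z.addState (φ i) (φ i) = Z.one) :
    measureIn X (phasedGHZ Z φ) =
      measureIn X (Z.ghz N) ≫ tensorHoms N (fun i => Z.phaseMap (φ i)) := by
  have hcopy : tensorHoms N (fun i => Z.phaseMap (φ i)) ≫ X.copyAll N =
      X.copyAll N ≫ (tensorHoms N (fun i => Z.phaseMap (φ i)) ⊗ₘ
        tensorHoms N (fun i => Z.phaseMap (φ i))) := by
    refine hom_ext fun x ⟨p, q⟩ => ?_
    simp only [comp_rel, exists_tensor, tensor_rel, tensorHoms_rel, copyAll_rel, ← forall_and]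
    rw [exists_forall_get fun i a => (Z.phaseMap (φ i)).rel (get N x i) a ∧
      X.comul.rel a (get N p i, get N q i)]
    simp only [phaseMap_comul_of_isClassical hZX (hφ _)]
    constructor
    · intro h
      choose f g h using h
      obtain ⟨f, rfl⟩ := (get_bijective (H := H) N).2 f
      obtain ⟨g, rfl⟩ := (get_bijective (H := H) N).2 g
      exact ⟨f, g, h⟩
    · rintro ⟨f, g, h⟩ i
      exact ⟨_, _, h i⟩
  have hunit : tensorHoms N (fun i => Z.phaseMap (φ i)) ≫
      (tensorHoms N (fun i => Z.phaseMap (φ i)))† = 𝟙 _ := by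
    rw [dagger_tensorHoms, tensorHoms_comp]
    simp only [phaseMap_comp_dagger Z (h2 _), tensorHoms_id]
  -- After copying, one set of phases reaches the outcomes; the other meets the daggers of the same
  -- phases inside the effect and cancels by `hunit`.
  rw [phasedGHZ, measureIn, measureIn, DaggerSMC.dagger_comp, Category.assoc, reassoc_of% hcopy,
    MonoidalCategory.tensorHom_def', Category.assoc, ← whisker_exchange_assoc,
    ← whiskerLeft_comp_assoc, reassoc_of% hunit]
  simp

end Complementary

/-! ### The local hidden variable model -/

/-- Marginalising to one measurement only selects, in each system, the input wire of the phase used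
there. -/
theorem localMap_keepOne {H : Spek} {Z X : DaggerQSCFA H} (σ : MerminScenario Z X) (s : Fin σ.S) :
    σ.localMap ≫ keepOne (discardAll X.counit σ.N) σ.S s =
      tensorHoms σ.N (fun i => keepOne X.counit σ.M (σ.setting s i)) := by
  rw [MerminScenario.localMap, Category.assoc, tensorHoms_regroup_keepOne]
  simp only [wire_keepOne]

/-- The toy theory is Mermin local. -/
theorem merminLocal : MerminLocal Spek := by
  rintro ⟨H, Z, X, hZX, σ, hσ⟩
  obtain ⟨π, hπ, hπK⟩ :=
    exists_retraction_of_add_self (TwoTorsion.add_self Z) (classicalTwoTorsion hZX)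
  let a (r : Fin σ.M) : TwoTorsion Z := ⟨(σ.a r).1, addState_self_of_isPhaseState Z (σ.a r).2⟩
  let b (r : Fin σ.M) : TwoTorsion Z := π (a r)
  have hb (r) : X.IsClassical (b r).1 := hπ _
  -- The hidden state copies each measured outcome of the plain GHZ state to the `M` wires of its
  -- system; wire `r` carries the retracted phase `b r`.
  refine hσ ⟨measureIn X (Z.ghz σ.N) ≫ tensorHoms σ.N (fun _ =>
    X.copyTo σ.M ≫ tensorHoms σ.M (fun r => Z.phaseMap (b r).1)), fun s => ?_⟩
  -- The original sum is classical, hence fixed by the retraction, although the summands may change.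
  have hsum : ∑ i, b (σ.setting s i) = ∑ i, a (σ.setting s i) := by
    rw [← map_sum]
    refine hπK _ ?_
    change X.IsClassical _
    rw [TwoTorsion.val_sum]
    exact σ.sum_classical s
  have hmeas : σ.measurement s = measureIn X (phasedGHZ Z fun i => (b (σ.setting s i)).1) := by
    rw [MerminScenario.measurement, phasedGHZ_eq, phasedGHZ_eq, ← TwoTorsion.val_sum Z, hsum,
      TwoTorsion.val_sum]
  rw [hmeas, measureIn_phasedGHZ hZX _ (fun i => hb _) fun i => (b _).2, localMap_keepOne,
    Category.assoc,
    tensorHoms_comp]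
  congr 2
  funext i
  -- The phases on discarded copies are absorbed by the counit, and copying followed by keeping one
  -- copy is the identity.
  rw [Category.assoc, tensorHoms_keepOne _ _ _ fun r =>
    phaseMap_counit_of_isClassical hZX (hb r) (b r).2, reassoc_of% copyTo_keepOne]

/-! ## The two observables of the toy bit -/

theorem Z_comul_rel (x : Fin 4) (y : Fin 4 × Fin 4) : Z.comul.rel x y ↔ copyRel x y :=
  copyHomOf_rel 1 x y

theorem Z_counit_rel (x : Fin 4) : Z.counit.rel x () ↔ deleteRel x () :=
  deleteHomOf_rel 1 x ()

theorem X_comul_rel (x y z : Fin 4) : X.comul.rel x (y, z) ↔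
    copyRel (Equiv.swap 1 2 x) (Equiv.swap 1 2 y, Equiv.swap 1 2 z) :=
  copyHomOf_rel (Equiv.swap 1 2) x (y, z)

theorem X_counit_rel (x : Fin 4) : X.counit.rel x () ↔ deleteRel (Equiv.swap 1 2 x) () :=
  deleteHomOf_rel (Equiv.swap 1 2) x ()

set_option maxRecDepth 100000 in
theorem bialgebra_aux : ∀ p q a b : Fin 4,
    (∃ c : Fin 4, copyRel (Equiv.swap 1 2 c) (Equiv.swap 1 2 p, Equiv.swap 1 2 q) ∧
      copyRel c (a, b)) ↔
    -- The quantifiers are nested behind the first condition, so that the enumeration can reject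
    -- most cases early.
    ∃ a1 b1 : Fin 4, copyRel p (a1, b1) ∧ ∃ a2 b2 : Fin 4, copyRel q (a2, b2) ∧
      copyRel (Equiv.swap 1 2 a) (Equiv.swap 1 2 a1, Equiv.swap 1 2 a2) ∧
      copyRel (Equiv.swap 1 2 b) (Equiv.swap 1 2 b1, Equiv.swap 1 2 b2) := by
  decide

theorem unit_copy_aux : ∀ a b : Fin 4,
    (∃ c : Fin 4, deleteRel (Equiv.swap 1 2 c) () ∧ copyRel c (a, b)) ↔
      deleteRel (Equiv.swap 1 2 a) () ∧ deleteRel (Equiv.swap 1 2 b) () := by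
  decide

theorem counit_copy_aux : ∀ a b : Fin 4,
    (∃ c : Fin 4, copyRel (Equiv.swap 1 2 c) (Equiv.swap 1 2 a, Equiv.swap 1 2 b) ∧
      deleteRel c ()) ↔ deleteRel a () ∧ deleteRel b () := by
  decide

theorem stronglyComplementary_Z_X : StronglyComplementary Z X where
  bialgebra := by
    refine hom_ext fun ⟨(p : Fin 4), (q : Fin 4)⟩ ⟨(a : Fin 4), (b : Fin 4)⟩ => ?_
    have h := bialgebra_aux p q a b
    simp only [← X_comul_rel] at h
    simp only [← Z_comul_rel] at h
    refine Iff.trans h ?_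
    constructor
    · rintro ⟨a1, b1, h1, a2, b2, h2, h3, h4⟩
      exact ⟨((a1, b1), a2, b2), ⟨h1, h2⟩, ((a1, a2), b1, b2), (tensorμ_rel ..).2 rfl, h3, h4⟩
    · rintro ⟨⟨⟨a1, b1⟩, a2, b2⟩, ⟨h1, h2⟩, w, h3, h4, h5⟩
      cases (tensorμ_rel ..).1 h3
      exact ⟨a1, b1, h1, a2, b2, h2, h4, h5⟩
  unit_copy := by
    refine state_ext fun ⟨(a : Fin 4), (b : Fin 4)⟩ => ?_
    have h := unit_copy_aux a b
    simp only [← X_counit_rel, ← Z_comul_rel] at h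
    rw [prodState_rel]
    exact h
  counit_copy := by
    refine hom_ext fun ⟨(a : Fin 4), (b : Fin 4)⟩ ⟨⟩ => ?_
    have h := counit_copy_aux a b
    simp only [← X_comul_rel, ← Z_counit_rel] at h
    exact h.trans ⟨fun h => ⟨((), ()), h, rfl⟩, fun ⟨((), ()), h, _⟩ => h⟩

/-! ### The phase group of the toy bit -/

/-- The permutation of `IV` exchanging `0` and `1` if `g.1 = 1`, and `2` and `3` if `g.2 = 1`. -/
def phasePerm (g : ZMod 2 × ZMod 2) : Equiv.Perm (Fin 4) :=
  (if g.1 = 0 then 1 else Equiv.swap 0 1) * (if g.2 = 0 then 1 else Equiv.swap 2 3)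

/-- The phase states of `Z`. -/
def phaseState (g : ZMod 2 × ZMod 2) : 𝟙_ Spek ⟶ IV := Z.one ≫ permHom (phasePerm g)

/-- Membership in a phase state of `Z`. -/
def phaseRel (g : ZMod 2 × ZMod 2) (x : Fin 4) : Prop :=
  -- The state has one point in {0, 1} and one in {2, 3}, each selected by its parity.
  if x.val < 2 then (x.val : ZMod 2) = g.1 else (x.val : ZMod 2) = g.2

instance (g : ZMod 2 × ZMod 2) (x : Fin 4) : Decidable (phaseRel g x) := by
  unfold phaseRel; infer_instance

theorem phaseRel_aux : ∀ (g : ZMod 2 × ZMod 2) (x : Fin 4),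
    (∃ y : Fin 4, deleteRel y () ∧ x = phasePerm g y) ↔ phaseRel g x := by
  decide

theorem phaseState_rel (g : ZMod 2 × ZMod 2) (x : Fin 4) :
    (phaseState g).rel () x ↔ phaseRel g x := by
  rw [← phaseRel_aux]
  simp only [← Z_counit_rel]
  rfl

theorem phaseRel_phase : ∀ (g : ZMod 2 × ZMod 2) (x : Fin 4),
    (∃ a b : Fin 4, phaseRel g a ∧ phaseRel g b ∧ copyRel a (b, x)) ↔ deleteRel x () := by
  decide

theorem phaseRel_injective : ∀ g h : ZMod 2 × ZMod 2,
    (∀ x, phaseRel g x ↔ phaseRel h x) → g = h := by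
  decide

theorem phaseRel_add : ∀ (g h : ZMod 2 × ZMod 2) (x : Fin 4),
    (∃ a b : Fin 4, phaseRel g a ∧ phaseRel h b ∧ copyRel x (a, b)) ↔ phaseRel (g + h) x := by
  decide

/-- The classical ones are {0, 2} and {1, 3}, the two blocks on which the coordinate copied by `X`
is constant. -/
theorem phaseRel_classical : ∀ g : ZMod 2 × ZMod 2,
    (∀ x y : Fin 4, (∃ a : Fin 4, phaseRel g a ∧
      copyRel (Equiv.swap 1 2 a) (Equiv.swap 1 2 x, Equiv.swap 1 2 y)) ↔
      phaseRel g x ∧ phaseRel g y) ↔ g.1 = g.2 := by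
  decide

/-- Boolean predicates make the sixteen subsets of `Fin 4` enumerable, so completeness of the list
of phase states is a finite check. -/
theorem exists_phaseRel : ∀ p : Fin 4 → Bool,
    (∀ x : Fin 4, (∃ a b : Fin 4, p a = true ∧ p b = true ∧ copyRel a (b, x)) ↔ deleteRel x ()) →
      ∃ g, ∀ x, p x = true ↔ phaseRel g x := by
  decide

theorem isPhaseState_phaseState (g : ZMod 2 × ZMod 2) : Z.IsPhaseState (phaseState g) := by
  refine (isPhaseState_iff Z _).2 fun (x : Fin 4) => ?_
  have h := phaseRel_phase g x
  simp only [← phaseState_rel, ← Z_counit_rel, ← Z_comul_rel] at h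
  exact h

theorem phaseState_injective : Function.Injective phaseState := fun g h hgh =>
  phaseRel_injective g h fun x => by rw [← phaseState_rel, hgh, phaseState_rel]

theorem addState_phaseState (g h : ZMod 2 × ZMod 2) :
    Z.addState (phaseState g) (phaseState h) = phaseState (g + h) := by
  refine state_ext fun (x : Fin 4) => ?_
  have h := phaseRel_add g h x
  simp only [← phaseState_rel, ← Z_comul_rel] at h
  exact (addState_rel Z _ _ x).trans h

theorem isClassical_phaseState (g : ZMod 2 × ZMod 2) :
    X.IsClassical (phaseState g) ↔ g.1 = g.2 := by
  have h := phaseRel_classical g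
  simp only [← phaseState_rel, ← X_comul_rel] at h
  exact (isClassical_iff X _).trans h

theorem exists_phaseState {φ : 𝟙_ Spek ⟶ IV} (hφ : Z.IsPhaseState φ) :
    ∃ g, φ = phaseState g := by
  classical
  have h := exists_phaseRel fun x => decide (φ.rel () x)
  simp only [decide_eq_true_eq, ← phaseState_rel, ← Z_counit_rel, ← Z_comul_rel] at h
  obtain ⟨g, hg⟩ := h ((isPhaseState_iff Z φ).1 hφ)
  exact ⟨g, state_ext hg⟩

/-- The phase group of `Z`. -/
noncomputable def phaseEquiv : ZMod 2 × ZMod 2 ≃ Z.PhaseState :=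
  Equiv.ofBijective (fun g => ⟨phaseState g, isPhaseState_phaseState g⟩)
    ⟨fun _ _ h => phaseState_injective (congrArg Subtype.val h),
      fun φ => (exists_phaseState φ.2).imp fun _ h => Subtype.ext h.symm⟩

theorem phaseState_phaseEquiv_symm (φ : Z.PhaseState) : phaseState (phaseEquiv.symm φ) = φ.1 :=
  congrArg Subtype.val (phaseEquiv.apply_symm_apply φ)

/-- The subgroup of the phase group of `Z` consisting of the classical states of `X`. -/
def diagonal : AddSubgroup (ZMod 2 × ZMod 2) :=
  ((AddMonoidHom.id (ZMod 2)).prod (AddMonoidHom.id (ZMod 2))).range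

theorem mem_diagonal_iff (g : ZMod 2 × ZMod 2) : g ∈ diagonal ↔ g.1 = g.2 :=
  ⟨fun ⟨_, h⟩ => h ▸ rfl, fun h => ⟨g.1, Prod.ext rfl h⟩⟩

end Spek

theorem mainTheorem5 :
    (StronglyComplementary Spek.Z Spek.X ∧
      ∃ (e : Spek.Z.PhaseState ≃ ZMod 2 × ZMod 2) (K : AddSubgroup (ZMod 2 × ZMod 2)),
        (∀ φ ψ χ : Spek.Z.PhaseState,
          Spek.Z.addState φ.1 ψ.1 = χ.1 ↔ e φ + e ψ = e χ) ∧
        (∀ φ : Spek.Z.PhaseState, Spek.X.IsClassical φ.1 ↔ e φ ∈ K) ∧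
        Nonempty (K ≃+ ZMod 2) ∧
        ¬ IsNontrivialAlgebraicExtension K) ∧
    MerminLocal Spek := by
  refine ⟨⟨Spek.stronglyComplementary_Z_X, Spek.phaseEquiv.symm, Spek.diagonal, fun φ ψ χ => ?_,
    fun φ => ?_, ?_, ?_⟩, Spek.merminLocal⟩
  · rw [← Spek.phaseState_phaseEquiv_symm φ, ← Spek.phaseState_phaseEquiv_symm ψ,
      ← Spek.phaseState_phaseEquiv_symm χ, Spek.addState_phaseState]
    exact Spek.phaseState_injective.eq_iff
  · rw [← Spek.phaseState_phaseEquiv_symm φ, Spek.isClassical_phaseState, Spek.mem_diagonal_iff]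
  -- The diagonal is the range of the injective map g ↦ (g, g), hence a copy of `ZMod 2`.
  · exact ⟨(AddMonoidHom.ofInjective fun _ _ h => congrArg Prod.fst h).symm⟩
  · exact not_isNontrivialAlgebraicExtension_of_add_self (by decide) _
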